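/- Define the cusp curve $\Gamma_c:\ (t_0,t_1)=(-6s^4+4s^3,\ 4s^3-3s^2+\tfrac14)$, $0\le s\le\tfrac12$, and let $\mathcal F$ be the open region of the $(t_0,t_1)$-plane bounded by the segments $[0,\tfrac18]\times\{0\}$, $\{0\}\times[0,\tfrac14]$ and $\Gamma_c$. The curve $$\gamma_c:\quad (t_0,t_1)=\bigl(-2s^{12}+s^6-9s^{10},\ \tfrac32 s^2-\tfrac94 s^4-6s^8\bigr),\qquad 0\le s\le \tfrac12,$$ splits $\mathcal F$ into the part $\mathcal F_1$ to the right of $\gamma_c$ and the part $\mathcal F_2$ to the left of $\gamma_c$ (between $\gamma_c$, $\Gamma_c$ and the $t_1$-axis). For $(t_0,t_1)\in\mathcal F$ let $r=r(t_0,t_1)$ be the smallest positive root of $$p(x)=128x^{10}-124x^8+(64t_0-16t_1+36)x^6+(16t_1^2+8t_1-28t_0-3)x^4+t_0(2-8t_1)x^2+t_0^2,$$ let $a_0=\tfrac12\bigl(1-4r^2-\sqrt{(1-4r^2)^2-4t_1}\bigr)$ and $h(w)=rw+a_0+\frac{2a_0r}{w}+\frac{r^2}{w^2}$, and let $\Omega$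 be the interior of the closed curve $h(\{|w|=1\})$. Let $$B=4a_0^3r^2+4a_0^2r^4+4a_0r^4-a_0r^2,$$ $$A=-\bigl(a_0^4(1-4r^2)-2a_0^3(1-2r^2)^2+a_0^2(-4r^6+6r^4-3r^2+1)+r^2(r^2-1)^3\bigr),$$ and let the spectral curve be $$F(\xi,z):=\xi^3+z^3-z^2\xi^2-t_1(\xi^2+z^2)-(1+t_0)z\xi+(B+t_1)(\xi+z)+A=0 .$$ Branch points refer to the three-valued algebraic function $\xi(z)$ defined by $F(\xi,z)=0$; a branch point $b$ has order $k\ge2$ if over $b$ there is a point of the Riemann surface of the curve at which exactly $k$ sheets of the projection to the $z$-sphere meet. A point $z\in\mathbb C$ is a critical point of the curve if $F=\partial F/\partial\xi=\partial F/\partial z=0$ at $(\xi,z)$ for some $\xi\in\mathbb C$. **Theorem.** Let $(t_0,t_1)\in\mathcal F$. 1. If $(t_0,t_1)\notin\gamma_c$, the spectral curve has exactly three finite branch points $z_0,z_1,z_2$; they are distinct and each has order two and no other order. Moreover: * (i) if $(t_0,t_1)\in\mathcal F_1$, then $z_0>0$, $\operatorname{Im} z_1<0$, $\overline{z_2}=z_1$,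 and $z_0,z_1,z_2\in\Omega$; * (ii) if $(t_0,t_1)\in\mathcal F_2$, then $z_0,z_1,z_2$ are real with $z_2<z_1<z_0$, $z_0>0$, and $z_0,z_1\in\Omega$. 2. (iii) If $(t_0,t_1)\in\gamma_c$, the finite branch points are exactly a point $z_0>0$ of order two and a point $z_1=z_2\in\mathbb R$ of order three; $z_1<z_0$, and $z_0,z_1\in\Omega$. 3. For all $(t_0,t_1)\in\mathcal F$, $\infty$ is a branch point of order two (and of no other order). 4. For all $(t_0,t_1)\in\mathcal F$, the spectral curve has exactly three critical points $\hat z_0,\hat z_1,\hat z_2$; they lie in $\mathbb C\setminus\overline\Omega$, $\hat z_0$ is real with $\hat z_0>z_0$, and $\hat z_1,\hat z_2$ are non-real with $\operatorname{Im}\hat z_1<0$ and $\overline{\hat z_2}=\hat z_1$. -/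

import Mathlib

open scoped Topology

noncomputable section

namespace CubicModel

/-! ### Phase diagram -/

/-- `t₀`-coordinate of the cusp curve `Γ_c`, `0 ≤ s ≤ 1/2`. -/
def cuspT0 (s : ℝ) : ℝ := -6 * s ^ 4 + 4 * s ^ 3

/-- `t₁`-coordinate of the cusp curve `Γ_c`, `0 ≤ s ≤ 1/2`. -/
def cuspT1 (s : ℝ) : ℝ := 4 * s ^ 3 - 3 * s ^ 2 + 1 / 4

/-- The open region `𝓕` of pairs `(t₀, t₁)` enclosed by the two coordinate segments
`[0, 1/8] × {0}`, `{0} × [0, 1/4]` and the curve `Γ_c`. On `[0, 1/2]` the function `cuspT1`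
decreases strictly from `1/4` to `0` and `cuspT0` increases strictly from `0` to `1/8`, so this
is the set of the points of the open first quadrant that have a point of `Γ_c` at the same
height `t₁`, strictly to their right. -/
def paramRegion : Set (ℝ × ℝ) :=
  {t | 0 < t.1 ∧ 0 < t.2 ∧
    ∃ s ∈ Set.Icc (0 : ℝ) (1 / 2), t.2 = cuspT1 s ∧ t.1 < cuspT0 s}

/-- `t₀`-coordinate of the curve `γ_c`, `0 ≤ s ≤ 1/2`. -/
def mbT0 (s : ℝ) : ℝ := -2 * s ^ 12 + s ^ 6 - 9 * s ^ 10

/-- `t₁`-coordinate of the curve `γ_c`, `0 ≤ s ≤ 1/2`. -/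
def mbT1 (s : ℝ) : ℝ := 3 / 2 * s ^ 2 - 9 / 4 * s ^ 4 - 6 * s ^ 8

/-- The curve `γ_c`. -/
def gammaC : Set (ℝ × ℝ) := {t | ∃ s ∈ Set.Icc (0 : ℝ) (1 / 2), t = (mbT0 s, mbT1 s)}

/-- The three-cut region `𝓕₁`: the points of `𝓕` to the right of `γ_c`. -/
def region1 : Set (ℝ × ℝ) :=
  {t | t ∈ paramRegion ∧ ∃ s ∈ Set.Icc (0 : ℝ) (1 / 2), t.2 = mbT1 s ∧ mbT0 s < t.1}

/-- The one-cut region `𝓕₂`: the rest of `𝓕 ∖ γ_c`, that is, the part of `𝓕` on the left side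
of `γ_c`, between `γ_c`, `Γ_c` and the `t₁`-axis. -/
def region2 : Set (ℝ × ℝ) := (paramRegion \ gammaC) \ region1

/-! ### The rational parametrization and the domain `Ω` -/

/-- The polynomial `p`, with coefficients depending on `(t₀, t₁)`. -/
def polyP (t0 t1 x : ℝ) : ℝ :=
  128 * x ^ 10 - 124 * x ^ 8 + (64 * t0 - 16 * t1 + 36) * x ^ 6
    + (16 * t1 ^ 2 + 8 * t1 - 28 * t0 - 3) * x ^ 4 + t0 * (2 - 8 * t1) * x ^ 2 + t0 ^ 2

/-- `r(t₀, t₁)`: the smallest positive root of `p`. -/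
def rParam (t0 t1 : ℝ) : ℝ := sInf {x : ℝ | 0 < x ∧ polyP t0 t1 x = 0}

/-- `a₀(t₀, t₁)`. -/
def aParam (t0 t1 : ℝ) : ℝ :=
  (1 - 4 * rParam t0 t1 ^ 2 - Real.sqrt ((1 - 4 * rParam t0 t1 ^ 2) ^ 2 - 4 * t1)) / 2

/-- The rational function `h(w) = r w + a₀ + 2 a₀ r / w + r² / w²`. -/
def hMap (t0 t1 : ℝ) (w : ℂ) : ℂ :=
  (rParam t0 t1 : ℂ) * w + (aParam t0 t1 : ℂ)
    + 2 * (aParam t0 t1 : ℂ) * (rParam t0 t1 : ℂ) / w + (rParam t0 t1 : ℂ) ^ 2 / w ^ 2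

/-- The closed curve `h(∂𝔻)`. -/
def boundaryCurve (t0 t1 : ℝ) : Set ℂ := hMap t0 t1 '' Metric.sphere (0 : ℂ) 1

/-- `Ω`: the interior of the closed curve `h(∂𝔻)`, i.e. the points off the curve whose connected
component in the complement of the curve is bounded. -/
def Omega (t0 t1 : ℝ) : Set ℂ :=
  {z | z ∈ (boundaryCurve t0 t1)ᶜ ∧
    Bornology.IsBounded (connectedComponentIn (boundaryCurve t0 t1)ᶜ z)}

/-! ### The spectral curve -/

/-- The coefficient `B` in terms of `r` and `a = a₀`. -/
def formB (r a : ℝ) : ℝ :=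
  4 * a ^ 3 * r ^ 2 + 4 * a ^ 2 * r ^ 4 + 4 * a * r ^ 4 - a * r ^ 2

/-- The coefficient `A` in terms of `r` and `a = a₀`. -/
def formA (r a : ℝ) : ℝ :=
  -(a ^ 4 * (1 - 4 * r ^ 2) - 2 * a ^ 3 * (1 - 2 * r ^ 2) ^ 2
    + a ^ 2 * (-4 * r ^ 6 + 6 * r ^ 4 - 3 * r ^ 2 + 1) + r ^ 2 * (r ^ 2 - 1) ^ 3)

/-- The coefficient `B(t₀, t₁)`. -/
def coeffB (t0 t1 : ℝ) : ℝ := formB (rParam t0 t1) (aParam t0 t1)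

/-- The coefficient `A(t₀, t₁)`. -/
def coeffA (t0 t1 : ℝ) : ℝ := formA (rParam t0 t1) (aParam t0 t1)

/-- The polynomial `F(ξ, z)`; the spectral curve is `F(ξ, z) = 0`. -/
def spectralF (t0 t1 : ℝ) (ξ z : ℂ) : ℂ :=
  ξ ^ 3 + z ^ 3 - z ^ 2 * ξ ^ 2 - (t1 : ℂ) * (ξ ^ 2 + z ^ 2) - (1 + (t0 : ℂ)) * z * ξ
    + ((coeffB t0 t1 : ℂ) + (t1 : ℂ)) * (ξ + z) + (coeffA t0 t1 : ℂ)

/-- The algebraic curve `F(ξ, z) = 0` has a (Puiseux) branch along which `z` runs as `Z τ`, for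
`τ` in a punctured neighbourhood of `0`: there is a germ `ξ = φ τ`, meromorphic at `0`, with
`F(φ τ, Z τ) = 0`, such that `τ ↦ (φ τ, Z τ)` is injective near `0`, so that `τ` is a local
uniformizer of the Riemann surface of the curve. -/
def HasBranchAlong (F : ℂ → ℂ → ℂ) (Z : ℂ → ℂ) : Prop :=
  ∃ φ : ℂ → ℂ, MeromorphicAt φ 0 ∧ (∀ᶠ τ in 𝓝[≠] (0 : ℂ), F (φ τ) (Z τ) = 0) ∧
    ∃ U ∈ 𝓝[≠] (0 : ℂ), Set.InjOn (fun τ => (φ τ, Z τ)) U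

/-- `b ∈ ℂ` is a branch point of order `k ≥ 2` of the algebraic function `ξ(z)` defined by
`F(ξ, z) = 0`: over `b` there is a point of the Riemann surface of the curve at which exactly `k`
sheets of the projection to the `z`-plane come together (ramification index `k`), with uniformizer
`τ` given by `z = b + τ ^ k`. -/
def IsBranchPoint (F : ℂ → ℂ → ℂ) (k : ℕ) (b : ℂ) : Prop :=
  2 ≤ k ∧ HasBranchAlong F (fun τ => b + τ ^ k)

/-- `∞` is a branch point of order `k ≥ 2` of the algebraic function `ξ(z)` defined by
`F(ξ, z) = 0`; the uniformizer `τ` is given by `z = τ ^ (-k)`. -/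
def IsBranchPointAtInfinity (F : ℂ → ℂ → ℂ) (k : ℕ) : Prop :=
  2 ≤ k ∧ HasBranchAlong F (fun τ => (τ ^ k)⁻¹)

/-- `z` is a critical point of the curve `F(ξ, z) = 0`: for some `ξ` with `F(ξ, z) = 0` both
partial derivatives of `F` vanish at `(ξ, z)`. -/
def IsCriticalPoint (F : ℂ → ℂ → ℂ) (z : ℂ) : Prop :=
  ∃ ξ : ℂ, F ξ z = 0 ∧ deriv (fun x => F x z) ξ = 0 ∧ deriv (fun y => F ξ y) z = 0

end CubicModel

end

/-! The whole statement is moved to a triangle. The map (r, a) ↦ (t₀, t₁) = (`paramT0`, `paramT1`)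
sends the side a + r = 1/2 to the cusp curve, and every point of the region is the image of some r,
a > 0 with a + r < 1/2. Along a level set of t₁ the value t₀ increases strictly with r
(`paramT0_lt`), so the smallest positive root of p really is r, and a₀ is a. The curve γ_c becomes
8a³ = 27r².

In these coordinates the spectral curve is rational: z = h(w), ξ = h(1/w). If w₁, w₂, w₃ are the
preimages of z under h, Vieta's formulas give F(ξ, z) = ∏ (ξ - h(1/wᵢ)) (`IsFiber.curveF`). The
bound 2a + 2r < 1 makes h injective on |w| ≥ 1. Hence z lies in Ω if all its preimages lie in the
open disc, and outside the closure of Ω if one of them has |w| > 1.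

Finite branch points are the critical values of h, at the roots of w³ = 2aw + 2r. The discriminant
of this cubic is 4(8a³ - 27r²), which yields the three cases. Over infinity only the double pole w =
0 ramifies. Critical points of the curve are its nodes, pairs w ≠ v with the same z and ξ; the
product P = wv satisfies (P - 1)(P² + (1 - 2a)P + 1) = 0 and determines z.

Since branch points are defined by Puiseux germs, such germs must be lifted to the w-sphere. Away
from nodes w is a rational function of z and ξ (`HasBranchAlong.exists_lift`), and comparing orders
of vanishing then identifies the ramification index. -/

noncomputable section

namespace CubicModel

/-! ### Parametrizing the phase diagram by (r, a) -/

/-- `t₁` as a function of `r` and `a₀`. -/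
def paramT1 (r a : ℝ) : ℝ := a * (1 - 4 * r ^ 2 - a)

/-- `t₀` as a function of `r` and `a₀`. -/
def paramT0 (r a : ℝ) : ℝ := r ^ 2 * (1 - 4 * a ^ 2 - 2 * r ^ 2)

/-- `paramT1` decreases in its first variable and, up to the vertex 2b = 1 - 4x², increases in its
second; so at constant t₁ the smaller root decreases with r. -/
theorem lt_of_paramT1_eq {r a x b : ℝ} (ha : 0 < a) (har : a + r ≤ 1 / 2)
    (hx : 0 < x) (hxr : x < r) (hb : 2 * b ≤ 1 - 4 * x ^ 2)
    (h : paramT1 x b = paramT1 r a) : b < a := by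
  unfold paramT1 at h
  have h1 : 2 * a ≤ 1 - 4 * r ^ 2 := by nlinarith
  have h2 : x ^ 2 < r ^ 2 := by nlinarith
  by_contra hc
  push Not at hc
  have h3 : 0 ≤ (b - a) * (1 - 4 * x ^ 2 - a - b) := mul_nonneg (by linarith) (by linarith)
  nlinarith [mul_pos ha (sub_pos.2 h2)]

theorem pos_of_paramT1_pos {x b : ℝ} (hx : 4 * x ^ 2 < 1) (h : 0 < paramT1 x b) : 0 < b := by
  unfold paramT1 at h
  by_contra hc
  push Not at hc
  nlinarith [mul_nonneg_of_nonpos_of_nonpos hc hc]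

/-- Eliminating a - b through the equality of the t₁-values leaves r² - x² times a bracket, whose
sign is the point. The estimates degenerate to equality at x = r, a = b = 1/2 - r, which is the cusp
curve. -/
theorem paramT0_lt_of_small {r a x b : ℝ} (ha : 0 < a) (har : a + r ≤ 1 / 2)
    (hx : 0 < x) (hxr : x < r) (hb : 2 * b ≤ 1 - 4 * x ^ 2)
    (h : paramT1 x b = paramT1 r a) : paramT0 x b < paramT0 r a := by
  have hba := lt_of_paramT1_eq ha har hx hxr hb h
  have hr : r < 1 / 2 := by linarith
  have h1 : 2 * a < 1 - 4 * r ^ 2 := by nlinarith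
  have hx2 : x ^ 2 < r ^ 2 := by nlinarith
  have hT : 0 < paramT1 r a := by unfold paramT1; exact mul_pos ha (by linarith)
  have hb0 : 0 < b := pos_of_paramT1_pos (by nlinarith) (h ▸ hT)
  unfold paramT1 at h
  unfold paramT0
  -- The cofactor of a - b in the equality of the two t₁-values, see `key`.
  set Q := 1 - a - b - 4 * r ^ 2 with hQ
  have hQ0 : 2 * r * (1 - 2 * r) < Q := by nlinarith
  have hr0 : 0 < r := by linarith
  have hQp : 0 < Q := lt_trans (by nlinarith) hQ0
  have key : (a - b) * Q = 4 * b * (r ^ 2 - x ^ 2) := by rw [hQ]; linarith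
  have hb2 : b * (a + b) < 2 * (1 / 2 - r) ^ 2 := by nlinarith
  have hbr : b ^ 2 ≤ (1 / 2 - r) ^ 2 := by nlinarith
  have main : 16 * r ^ 2 * (b * (a + b)) < (1 - 2 * r ^ 2 - 2 * x ^ 2 - 4 * b ^ 2) * Q := by
    have e1 : 4 * r * (1 - 2 * r) ≤ 1 - 2 * r ^ 2 - 2 * x ^ 2 - 4 * b ^ 2 := by nlinarith
    have e2 : 0 < r * (1 - 2 * r) := mul_pos hr0 (by linarith)
    calc 16 * r ^ 2 * (b * (a + b)) < 16 * r ^ 2 * (2 * (1 / 2 - r) ^ 2) := by gcongr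
      _ = (4 * r * (1 - 2 * r)) * (2 * r * (1 - 2 * r)) := by ring
      _ ≤ (1 - 2 * r ^ 2 - 2 * x ^ 2 - 4 * b ^ 2) * Q := by
        apply mul_le_mul e1 hQ0.le <;> nlinarith
  have fin : 0 < (r ^ 2 * (1 - 4 * a ^ 2 - 2 * r ^ 2) - x ^ 2 * (1 - 4 * b ^ 2 - 2 * x ^ 2)) * Q := by
    have : (r ^ 2 * (1 - 4 * a ^ 2 - 2 * r ^ 2) - x ^ 2 * (1 - 4 * b ^ 2 - 2 * x ^ 2)) * Q =
        (r ^ 2 - x ^ 2) *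
          ((1 - 2 * r ^ 2 - 2 * x ^ 2 - 4 * b ^ 2) * Q - 16 * r ^ 2 * (b * (a + b))) := by
      linear_combination (-4 * r ^ 2 * (a + b)) * key
    rw [this]
    exact mul_pos (by linarith) (by linarith)
  have := pos_of_mul_pos_left fin hQp.le
  linarith

/-- The larger root b has the larger square, hence gives an even smaller t₀ than the conjugate root
1 - 4x² - b. Both roots must be covered because p does not distinguish them. -/
theorem paramT0_lt {r a x b : ℝ} (ha : 0 < a) (har : a + r ≤ 1 / 2)
    (hx : 0 < x) (hxr : x < r) (h : paramT1 x b = paramT1 r a) :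
    paramT0 x b < paramT0 r a := by
  rcases le_or_gt (2 * b) (1 - 4 * x ^ 2) with hb | hb
  · exact paramT0_lt_of_small ha har hx hxr hb h
  · have h2 : paramT1 x (1 - 4 * x ^ 2 - b) = paramT1 r a := by
      rw [← h]; unfold paramT1; ring
    have := paramT0_lt_of_small ha har hx hxr (by linarith) h2
    refine lt_of_le_of_lt ?_ this
    unfold paramT0
    have hx4 : 4 * x ^ 2 < 1 := by nlinarith
    have : (1 - 4 * x ^ 2 - b) ^ 2 ≤ b ^ 2 := by nlinarith
    have hx2 : 0 < x ^ 2 := by positivity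
    nlinarith

theorem param_unique {r a x b : ℝ} (hr : 0 < r) (ha : 0 < a) (har : a + r ≤ 1 / 2)
    (hx : 0 < x) (hb : 0 < b) (hbx : b + x ≤ 1 / 2) (h1 : paramT1 x b = paramT1 r a)
    (h0 : paramT0 x b = paramT0 r a) : x = r ∧ b = a := by
  have e : x = r := by
    rcases lt_trichotomy x r with h | h | h
    · exact absurd h0 (paramT0_lt ha har hx h h1).ne
    · exact h
    · exact absurd h0 (paramT0_lt hb hbx hr h h1.symm).ne'
  refine ⟨e, ?_⟩
  subst e
  unfold paramT1 at h1
  have : (b - a) * (1 - 4 * x ^ 2 - a - b) = 0 := by linarith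
  rcases mul_eq_zero.1 this with h | h
  · linarith
  · nlinarith

/-- Intermediate values at fixed height t₁: along the smaller root b(x), the value of t₀ runs from 0
at x = 0 to the cusp curve at x = s, where b(s) = 1/2 - s. -/
theorem paramRegion_exists {t0 t1 : ℝ} (ht : (t0, t1) ∈ paramRegion) :
    ∃ r a, 0 < r ∧ 0 < a ∧ a + r < 1 / 2 ∧ t1 = paramT1 r a ∧ t0 = paramT0 r a := by
  obtain ⟨h0, h1, s, ⟨hs0, hs1⟩, e1, e0⟩ := ht
  simp only at h0 h1 e1 e0
  let b : ℝ → ℝ := fun x => (1 - 4 * x ^ 2 - Real.sqrt ((1 - 4 * x ^ 2) ^ 2 - 4 * t1)) / 2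
  have hbc : Continuous b := by fun_prop
  have hsp : 0 < s := by
    rcases hs0.eq_or_lt with h | h
    · subst h; norm_num [cuspT0] at e0; linarith
    · exact h
  have hs2 : s < 1 / 2 := by
    rcases hs1.eq_or_lt with h | h
    · subst h; norm_num [cuspT1] at e1; linarith
    · exact h
  have hT : t1 = (1 / 2 - s) * (1 - 4 * s ^ 2 - (1 / 2 - s)) := by rw [e1]; unfold cuspT1; ring
  have hbs : b s = 1 / 2 - s := by
    have : (1 - 4 * s ^ 2) ^ 2 - 4 * t1 = (1 - 4 * s ^ 2 - 2 * (1 / 2 - s)) ^ 2 := by rw [hT]; ring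
    simp only [b]
    rw [this, Real.sqrt_sq (by nlinarith)]; ring
  have hcont : ContinuousOn (fun x => paramT0 x (b x)) (Set.Icc 0 s) := by
    unfold paramT0; fun_prop
  have hmem : t0 ∈ Set.Ioo (paramT0 0 (b 0)) (paramT0 s (b s)) := by
    constructor
    · simpa [paramT0] using h0
    · rw [hbs]; refine e0.trans_eq ?_; unfold cuspT0 paramT0; ring
  obtain ⟨r, ⟨hr0, hrs⟩, hr⟩ := intermediate_value_Ioo hs0 hcont hmem
  have hr2 : r ^ 2 < s ^ 2 := by nlinarith
  have hdisc : 0 ≤ (1 - 4 * r ^ 2) ^ 2 - 4 * t1 := by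
    have : (1 - 4 * s ^ 2) ^ 2 - 4 * t1 = (1 - 4 * s ^ 2 - 2 * (1 / 2 - s)) ^ 2 := by rw [hT]; ring
    have h2 : (1 - 4 * s ^ 2) ^ 2 ≤ (1 - 4 * r ^ 2) ^ 2 := by
      have : 0 ≤ 1 - 4 * s ^ 2 := by nlinarith
      gcongr
    linarith [sq_nonneg (1 - 4 * s ^ 2 - 2 * (1 / 2 - s))]
  have hbr : paramT1 r (b r) = t1 := by
    have := Real.sq_sqrt hdisc
    simp only [b, paramT1]
    linear_combination (-1 / 4) * this
  have hsb : paramT1 s (1 / 2 - s) = t1 := by rw [hT]; unfold paramT1; ring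
  have hba : b r < 1 / 2 - s := by
    refine lt_of_paramT1_eq (r := s) (x := r) (by linarith) (by linarith) hr0 hrs ?_
      (hbr.trans hsb.symm)
    simp only [b]
    have := Real.sqrt_nonneg ((1 - 4 * r ^ 2) ^ 2 - 4 * t1)
    linarith
  refine ⟨r, b r, hr0, pos_of_paramT1_pos (x := r) (by nlinarith) (hbr ▸ h1), by linarith,
    hbr.symm, hr.symm⟩

/-- The polynomial p eliminates b: with V = x² - 2x⁴ - t₀ the first equation says V = 4x²b², and
squaring b² + t₁ = (1 - 4x²)b gives p = 0. Conversely V ≥ 0, and the sign lost by squaring is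
absorbed in the choice b = ±c. -/
theorem polyP_eq_zero_iff {t0 t1 x : ℝ} (hx : 0 < x) (hx2 : x < 1 / 2) :
    polyP t0 t1 x = 0 ↔ ∃ b, t1 = paramT1 x b ∧ t0 = paramT0 x b := by
  have hP : polyP t0 t1 x = (x ^ 2 - 2 * x ^ 4 - t0 + 4 * x ^ 2 * t1) ^ 2
      - 4 * x ^ 2 * (1 - 4 * x ^ 2) ^ 2 * (x ^ 2 - 2 * x ^ 4 - t0) := by
    unfold polyP; ring
  constructor
  · intro h
    rw [hP] at h
    set V := x ^ 2 - 2 * x ^ 4 - t0 with hV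
    have hV0 : 0 ≤ V := by
      by_contra hc
      push Not at hc
      have e1 : 0 ≤ 4 * x ^ 2 * (1 - 4 * x ^ 2) ^ 2 := by positivity
      have e2 : (V + 4 * x ^ 2 * t1) ^ 2 ≤ 0 := by nlinarith
      have e3 : V + 4 * x ^ 2 * t1 = 0 := by nlinarith
      have e4 : (1 - 4 * x ^ 2) ^ 2 * V = 0 := by
        have : 4 * x ^ 2 * ((1 - 4 * x ^ 2) ^ 2 * V) = 0 := by rw [e3] at h; linarith
        rcases mul_eq_zero.1 this with h | h
        · nlinarith [pow_pos hx 2]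
        · exact h
      have e5 : 1 - 4 * x ^ 2 = 0 := by
        rcases mul_eq_zero.1 e4 with h | h
        · exact pow_eq_zero_iff (two_ne_zero) |>.1 h
        · exact absurd h hc.ne
      nlinarith
    set c := Real.sqrt V / (2 * x) with hc
    have hcV : 4 * x ^ 2 * c ^ 2 = V := by
      rw [hc]; field_simp; rw [Real.sq_sqrt hV0]; ring
    have : (c ^ 2 + t1 - (1 - 4 * x ^ 2) * c) * (c ^ 2 + t1 + (1 - 4 * x ^ 2) * c) = 0 := by
      have : 16 * x ^ 4 * ((c ^ 2 + t1 - (1 - 4 * x ^ 2) * c) * (c ^ 2 + t1 + (1 - 4 * x ^ 2) * c))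
          = 0 := by
        rw [← hcV] at h; linear_combination h
      rcases mul_eq_zero.1 this with h | h
      · have := pow_pos hx 4; nlinarith
      · exact h
    rcases mul_eq_zero.1 this with h | h
    · exact ⟨c, by unfold paramT1; linarith, by unfold paramT0; linarith⟩
    · exact ⟨-c, by unfold paramT1; linarith, by unfold paramT0; linarith⟩
  · rintro ⟨b, rfl, rfl⟩
    rw [hP]; unfold paramT0 paramT1; ring

theorem rParam_paramT {r a : ℝ} (hr : 0 < r) (ha : 0 < a) (har : a + r < 1 / 2) :
    rParam (paramT0 r a) (paramT1 r a) = r := by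
  refine IsLeast.csInf_eq ⟨⟨hr, (polyP_eq_zero_iff hr (by linarith)).2 ⟨a, rfl, rfl⟩⟩, ?_⟩
  rintro x ⟨hx, h⟩
  by_contra hc
  push Not at hc
  obtain ⟨b, h1, h0⟩ := (polyP_eq_zero_iff hx (by linarith)).1 h
  exact absurd h0 (paramT0_lt ha har.le hx hc h1.symm).ne'

theorem aParam_paramT {r a : ℝ} (hr : 0 < r) (ha : 0 < a) (har : a + r < 1 / 2) :
    aParam (paramT0 r a) (paramT1 r a) = a := by
  unfold aParam
  rw [rParam_paramT hr ha har]
  have : (1 - 4 * r ^ 2) ^ 2 - 4 * paramT1 r a = (1 - 4 * r ^ 2 - 2 * a) ^ 2 := by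
    unfold paramT1; ring
  rw [this, Real.sqrt_sq (by nlinarith)]
  ring

/-! ### The curve γ_c and its two sides in terms of 8a³ - 27r² -/

theorem mbT0_eq (s : ℝ) : mbT0 s = paramT0 (s ^ 3) (3 / 2 * s ^ 2) := by
  unfold mbT0 paramT0; ring

theorem mbT1_eq (s : ℝ) : mbT1 s = paramT1 (s ^ 3) (3 / 2 * s ^ 2) := by
  unfold mbT1 paramT1; ring

theorem mbT1_strictMonoOn : StrictMonoOn mbT1 (Set.Icc 0 (1 / 2)) := by
  rintro s ⟨hs, _⟩ t ⟨_, ht⟩ hst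
  have hu : s ^ 2 < t ^ 2 := by gcongr
  have hv : t ^ 2 ≤ 1 / 4 := by nlinarith
  have hu0 : 0 ≤ s ^ 2 := sq_nonneg s
  unfold mbT1
  have e : 3 / 2 * t ^ 2 - 9 / 4 * t ^ 4 - 6 * t ^ 8 - (3 / 2 * s ^ 2 - 9 / 4 * s ^ 4 - 6 * s ^ 8)
    = (t ^ 2 - s ^ 2) * (3 / 2 - 9 / 4 * (t ^ 2 + s ^ 2)
      - 6 * ((t ^ 2 + s ^ 2) * ((t ^ 2) ^ 2 + (s ^ 2) ^ 2))) := by ring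
  have h1 : t ^ 2 + s ^ 2 < 1 / 2 := by linarith
  have h2 : (t ^ 2) ^ 2 + (s ^ 2) ^ 2 ≤ 1 / 8 := by nlinarith
  have h3 : (t ^ 2 + s ^ 2) * ((t ^ 2) ^ 2 + (s ^ 2) ^ 2) ≤ 1 / 2 * (1 / 8) := by
    apply mul_le_mul h1.le h2 <;> positivity
  have h4 := mul_pos (sub_pos.2 hu) (show 0 < 3 / 2 - 9 / 4 * (t ^ 2 + s ^ 2)
      - 6 * ((t ^ 2 + s ^ 2) * ((t ^ 2) ^ 2 + (s ^ 2) ^ 2)) by linarith)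
  linarith

theorem exists_sq_eq {a : ℝ} (ha : 0 < a) : ∃ σ, 0 < σ ∧ a = 3 / 2 * σ ^ 2 :=
  ⟨Real.sqrt (2 * a / 3), by positivity, by rw [Real.sq_sqrt (by positivity)]; ring⟩

theorem pos_of_mb_pos {s : ℝ} (hs : 0 ≤ s) (h : 0 < mbT1 s) : 0 < s := by
  rcases hs.eq_or_lt with e | e
  · subst e; simp [mbT1] at h
  · exact e

theorem paramT1_pos {r a : ℝ} (hr : 0 < r) (ha : 0 < a) (har : a + r < 1 / 2) :
    0 < paramT1 r a := by
  unfold paramT1; exact mul_pos ha (by nlinarith)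

theorem mb_sum_le {s : ℝ} (hs : 0 < s) (hs2 : s ≤ 1 / 2) : 3 / 2 * s ^ 2 + s ^ 3 ≤ 1 / 2 := by
  have h2 : s ^ 2 ≤ (1 / 2) ^ 2 := by gcongr
  have h3 : s ^ 3 ≤ (1 / 2) ^ 3 := by gcongr
  linarith

theorem lt_half_of_mb_sum_lt {s : ℝ} (h : 3 / 2 * s ^ 2 + s ^ 3 < 1 / 2) : s < 1 / 2 := by
  by_contra hc
  push Not at hc
  have h2 : (1 / 2) ^ 2 ≤ s ^ 2 := by gcongr
  have h3 : (1 / 2) ^ 3 ≤ s ^ 3 := by gcongr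
  linarith

theorem gammaC_iff {r a : ℝ} (hr : 0 < r) (ha : 0 < a) (har : a + r < 1 / 2) :
    (paramT0 r a, paramT1 r a) ∈ gammaC ↔ 8 * a ^ 3 = 27 * r ^ 2 := by
  constructor
  · rintro ⟨s, ⟨hs, hs2⟩, h⟩
    obtain ⟨h0, h1⟩ := Prod.mk.inj h
    have hs0 := pos_of_mb_pos hs (h1 ▸ paramT1_pos hr ha har)
    rw [mbT0_eq] at h0
    rw [mbT1_eq] at h1
    obtain ⟨e1, e2⟩ := param_unique hr ha har.le (by positivity) (by positivity)
      (mb_sum_le hs0 hs2) h1.symm h0.symm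
    rw [← e1, ← e2]; ring
  · intro h
    obtain ⟨σ, hσ, e⟩ := exists_sq_eq ha
    have hrσ : r = σ ^ 3 := by
      have : r ^ 2 = (σ ^ 3) ^ 2 := by rw [e] at h; linarith
      exact (pow_left_inj₀ hr.le (by positivity) two_ne_zero).1 this
    subst hrσ e
    exact ⟨σ, ⟨hσ.le, (lt_half_of_mb_sum_lt har).le⟩, by rw [mbT0_eq, mbT1_eq]⟩

/-- Being to the right of the point with parameter s forces s³ < r and (3/2)s² < a. If the
inequality failed, writing a = (3/2)σ² would give σ > s and r ≤ σ³, so t₁ would be at least the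
height of γ_c at σ, against the monotonicity of that height. -/
theorem lt_of_region1 {r a : ℝ} (hr : 0 < r) (ha : 0 < a) (har : a + r < 1 / 2)
    (h : (paramT0 r a, paramT1 r a) ∈ region1) : 8 * a ^ 3 < 27 * r ^ 2 := by
  obtain ⟨_, s, ⟨hs, hs2⟩, h1, h0⟩ := h
  simp only at h1 h0
  have hs0 := pos_of_mb_pos hs (h1 ▸ paramT1_pos hr ha har)
  have h1' := h1
  rw [mbT0_eq] at h0
  rw [mbT1_eq] at h1
  have hsum := mb_sum_le hs0 hs2
  have hsr : s ^ 3 < r := by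
    rcases lt_trichotomy (s ^ 3) r with hc | hc | hc
    · exact hc
    · exfalso
      rw [hc] at h0 h1 hsum
      have e : a = 3 / 2 * s ^ 2 := by
        unfold paramT1 at h1
        have : (a - 3 / 2 * s ^ 2) * (1 - 4 * r ^ 2 - a - 3 / 2 * s ^ 2) = 0 := by linarith
        rcases mul_eq_zero.1 this with h | h
        · linarith
        · nlinarith
      rw [e] at h0
      exact lt_irrefl _ h0
    · exact absurd h0 (paramT0_lt (by positivity) hsum hr hc h1).le.not_gt
  have hba : 3 / 2 * s ^ 2 < a := by
    refine lt_of_paramT1_eq ha har.le (by positivity) hsr ?_ h1.symm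
    have : 0 < s ^ 3 := by positivity
    nlinarith
  by_contra hc
  push Not at hc
  obtain ⟨σ, hσ, e⟩ := exists_sq_eq ha
  have hrσ : r ≤ σ ^ 3 := by
    have : r ^ 2 ≤ (σ ^ 3) ^ 2 := by rw [e] at hc; linarith
    exact (pow_le_pow_iff_left₀ hr.le (by positivity) two_ne_zero).1 this
  have hsσ : s < σ := by
    have : s ^ 2 < σ ^ 2 := by linarith
    exact (pow_lt_pow_iff_left₀ hs hσ.le two_ne_zero).1 this
  rcases le_or_gt σ (1 / 2) with h2 | h2
  · have m := mbT1_strictMonoOn ⟨hs, hs2⟩ ⟨hσ.le, h2⟩ hsσ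
    rw [← h1', mbT1_eq, ← e] at m
    unfold paramT1 at m
    have : r ^ 2 ≤ (σ ^ 3) ^ 2 := by gcongr
    nlinarith
  -- Here σ is beyond the parameter interval. Since r < 1/2 - a, t₁ exceeds a²(3 - 4a), which
  -- increases for 3/8 < a < 1/2 and equals 27/128, the height of γ_c at its end, at a = 3/8.
  · have m := mbT1_strictMonoOn.monotoneOn ⟨hs, hs2⟩ (Set.right_mem_Icc.2 (by norm_num)) hs2
    rw [← h1'] at m
    norm_num [mbT1] at m
    have ha8 : 3 / 8 < a := by
      have : (1 / 2) ^ 2 < σ ^ 2 := by gcongr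
      linarith
    have hr2 : r ^ 2 < (1 / 2 - a) ^ 2 := by
      have : r < 1 / 2 - a := by linarith
      gcongr
    unfold paramT1 at m
    have e1 : a ^ 2 * (3 - 4 * a) < 27 / 128 := by nlinarith
    have e2 : 0 < (a - 3 / 8) * (1 / 2 - a) := mul_pos (by linarith) (by linarith)
    nlinarith [mul_pos e2 ha, mul_pos e2 (sub_pos.2 ha8)]

/-- Now σ³ < r, so γ_c at σ lies above t₁; an intermediate s < σ has height exactly t₁, and
`paramT0_lt` compares s³ with r. -/
theorem mem_region1 {r a : ℝ} (hr : 0 < r) (ha : 0 < a) (har : a + r < 1 / 2)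
    (hF : (paramT0 r a, paramT1 r a) ∈ paramRegion) (h : 8 * a ^ 3 < 27 * r ^ 2) :
    (paramT0 r a, paramT1 r a) ∈ region1 := by
  refine ⟨hF, ?_⟩
  simp only
  obtain ⟨σ, hσ, e⟩ := exists_sq_eq ha
  have hrσ : σ ^ 3 < r := by
    have : (σ ^ 3) ^ 2 < r ^ 2 := by rw [e] at h; linarith
    exact (pow_lt_pow_iff_left₀ (by positivity) hr.le two_ne_zero).1 this
  have hσ2 : σ < 1 / 2 := lt_half_of_mb_sum_lt (by linarith)
  have hlt : paramT1 r a < mbT1 σ := by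
    rw [mbT1_eq, ← e]
    unfold paramT1
    have : (σ ^ 3) ^ 2 < r ^ 2 := by gcongr
    nlinarith
  have hc : ContinuousOn mbT1 (Set.Icc 0 σ) := by unfold mbT1; fun_prop
  obtain ⟨s, ⟨hs0, hs⟩, hs1⟩ := intermediate_value_Ioo hσ.le hc
    (show paramT1 r a ∈ Set.Ioo _ _ from
      ⟨by simpa [mbT1] using paramT1_pos hr ha har, hlt⟩)
  refine ⟨s, ⟨hs0.le, by linarith⟩, hs1.symm, ?_⟩
  rw [mbT0_eq]
  rw [mbT1_eq] at hs1
  refine paramT0_lt ha har.le (by positivity) (lt_trans ?_ hrσ) hs1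
  gcongr

theorem lt_of_region2 {r a : ℝ} (hr : 0 < r) (ha : 0 < a) (har : a + r < 1 / 2)
    (h : (paramT0 r a, paramT1 r a) ∈ region2) : 27 * r ^ 2 < 8 * a ^ 3 := by
  obtain ⟨⟨hF, hg⟩, h1⟩ := h
  rw [gammaC_iff hr ha har] at hg
  rcases lt_trichotomy (8 * a ^ 3) (27 * r ^ 2) with h | h | h
  · exact absurd (mem_region1 hr ha har hF h) h1
  · exact absurd h hg
  · exact h

/-! ### Rational parametrization of the spectral curve -/

/-- The spectral curve polynomial in terms of `r` and `a₀`. -/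
def curveF (r a ξ z : ℂ) : ℂ :=
  ξ ^ 3 + z ^ 3 - z ^ 2 * ξ ^ 2 - a * (1 - 4 * r ^ 2 - a) * (ξ ^ 2 + z ^ 2)
    - (1 + r ^ 2 * (1 - 4 * a ^ 2 - 2 * r ^ 2)) * z * ξ
    + (4 * a ^ 3 * r ^ 2 + 4 * a ^ 2 * r ^ 4 + 4 * a * r ^ 4 - a * r ^ 2
      + a * (1 - 4 * r ^ 2 - a)) * (ξ + z)
    - (a ^ 4 * (1 - 4 * r ^ 2) - 2 * a ^ 3 * (1 - 2 * r ^ 2) ^ 2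
    + a ^ 2 * (-4 * r ^ 6 + 6 * r ^ 4 - 3 * r ^ 2 + 1) + r ^ 2 * (r ^ 2 - 1) ^ 3)

theorem curveF_symm (r a ξ z : ℂ) : curveF r a ξ z = curveF r a z ξ := by
  unfold curveF; ring

/-- Vieta's relations express r and a as polynomials in the wᵢ, after which this is a polynomial
identity. The roots in ξ are the values h(1/wᵢ), with r/w₁ rewritten as -w₂w₃ to avoid denominators.
-/
theorem curveF_eq_prod {r a : ℂ} (w₁ w₂ w₃ ξ : ℂ) (h2 : w₁ * w₂ + w₁ * w₃ + w₂ * w₃ = 2 * a)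
    (h3 : w₁ * w₂ * w₃ = -r) :
    curveF r a ξ (a + r * (w₁ + w₂ + w₃)) =
      (ξ - (a - w₂ * w₃ + 2 * a * r * w₁ + r ^ 2 * w₁ ^ 2)) *
      (ξ - (a - w₁ * w₃ + 2 * a * r * w₂ + r ^ 2 * w₂ ^ 2)) *
      (ξ - (a - w₁ * w₂ + 2 * a * r * w₃ + r ^ 2 * w₃ ^ 2)) := by
  obtain rfl : r = -(w₁ * w₂ * w₃) := by rw [h3]; ring
  obtain rfl : a = (w₁ * w₂ + w₁ * w₃ + w₂ * w₃) / 2 := by rw [h2]; ring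
  unfold curveF
  ring

/-- The rational parametrization in terms of `r` and `a₀`. -/
def ratMap (r a w : ℂ) : ℂ := r * w + a + 2 * a * r / w + r ^ 2 / w ^ 2

/-- `w₁, w₂, w₃` are the solutions, with multiplicity, of `ratMap r a w = z`. -/
def IsFiber (r a z w₁ w₂ w₃ : ℂ) : Prop :=
  a + r * (w₁ + w₂ + w₃) = z ∧ w₁ * w₂ + w₁ * w₃ + w₂ * w₃ = 2 * a ∧ w₁ * w₂ * w₃ = -r

theorem IsFiber.rotate {r a z w₁ w₂ w₃ : ℂ} (h : IsFiber r a z w₁ w₂ w₃) :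
    IsFiber r a z w₂ w₃ w₁ := by
  obtain ⟨h1, h2, h3⟩ := h
  exact ⟨by rw [← h1]; ring, by rw [← h2]; ring, by rw [← h3]; ring⟩

theorem IsFiber.ne_zero {r a z w₁ w₂ w₃ : ℂ} (h : IsFiber r a z w₁ w₂ w₃) (hr : r ≠ 0) :
    w₁ ≠ 0 := by
  rintro rfl
  exact hr (by simpa using h.2.2.symm)

theorem IsFiber.ratMap_sub {r a z w₁ w₂ w₃ w : ℂ} (h : IsFiber r a z w₁ w₂ w₃) (hw : w ≠ 0) :
    ratMap r a w - z = r * ((w - w₁) * (w - w₂) * (w - w₃)) / w ^ 2 := by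
  obtain ⟨h1, h2, h3⟩ := h
  unfold ratMap
  rw [← h1]
  field_simp
  linear_combination (-r * w) * h2 + r * h3

theorem IsFiber.ratMap_eq_iff {r a z w₁ w₂ w₃ w : ℂ} (h : IsFiber r a z w₁ w₂ w₃) (hr : r ≠ 0)
    (hw : w ≠ 0) : ratMap r a w = z ↔ w = w₁ ∨ w = w₂ ∨ w = w₃ := by
  rw [← sub_eq_zero, h.ratMap_sub hw]
  simp [hw, hr, sub_eq_zero, or_assoc]

theorem IsFiber.ratMap_eq {r a z w₁ w₂ w₃ : ℂ} (h : IsFiber r a z w₁ w₂ w₃) (hr : r ≠ 0) :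
    ratMap r a w₁ = z := (h.ratMap_eq_iff hr (h.ne_zero hr)).2 (Or.inl rfl)

theorem IsFiber.ratMap_inv {r a z w₁ w₂ w₃ : ℂ} (h : IsFiber r a z w₁ w₂ w₃) (hr : r ≠ 0) :
    ratMap r a w₁⁻¹ = a - w₂ * w₃ + 2 * a * r * w₁ + r ^ 2 * w₁ ^ 2 := by
  have hw := h.ne_zero hr
  obtain ⟨h1, h2, h3⟩ := h
  have : r * w₁⁻¹ = - (w₂ * w₃) := by
    field_simp
    linear_combination h3
  unfold ratMap
  rw [this]
  field_simp
  ring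

theorem exists_isFiber {r : ℂ} (hr : r ≠ 0) (a z : ℂ) : ∃ w₁ w₂ w₃, IsFiber r a z w₁ w₂ w₃ := by
  obtain ⟨w, hw⟩ : ∃ w : ℂ, r * w ^ 3 + (a - z) * w ^ 2 + 2 * a * r * w + r ^ 2 = 0 := by
    have hd : (Polynomial.C r * Polynomial.X ^ 3 + Polynomial.C (a - z) * Polynomial.X ^ 2
      + Polynomial.C (2 * a * r) * Polynomial.X + Polynomial.C (r ^ 2)).degree = 3 :=
      Polynomial.degree_cubic hr
    obtain ⟨w, hw⟩ := IsAlgClosed.exists_root _ (hd.trans_ne (by decide))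
    exact ⟨w, by simpa using hw⟩
  have hw0 : w ≠ 0 := by rintro rfl; simp [hr] at hw
  -- the remaining two points solve `X² - σ X + π = 0`
  set σ := (z - a) / r - w with hσ
  set π := -r / w with hπ
  obtain ⟨δ, hδ⟩ := IsAlgClosed.exists_pow_nat_eq (σ ^ 2 - 4 * π) (n := 2) two_pos
  refine ⟨w, (σ + δ) / 2, (σ - δ) / 2, ?_, ?_, ?_⟩
  · rw [hσ]; field_simp; ring
  · have e : w * σ + π = 2 * a := by
      rw [hσ, hπ]; field_simp
      linear_combination -hw
    linear_combination e - (1 / 4) * hδ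
  · have e : w * π = -r := by rw [hπ]; field_simp
    linear_combination e - (w / 4) * hδ

theorem IsFiber.curveF {r a z w₁ w₂ w₃ : ℂ} (h : IsFiber r a z w₁ w₂ w₃) (hr : r ≠ 0) (ξ : ℂ) :
    curveF r a ξ z = (ξ - ratMap r a w₁⁻¹) * (ξ - ratMap r a w₂⁻¹) * (ξ - ratMap r a w₃⁻¹) := by
  rw [h.ratMap_inv hr, h.rotate.ratMap_inv hr, h.rotate.rotate.ratMap_inv hr, ← h.1,
    curveF_eq_prod w₁ w₂ w₃ ξ h.2.1 h.2.2]
  ring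

theorem curveF_eq_zero_iff {r : ℂ} (hr : r ≠ 0) (a ξ z : ℂ) :
    curveF r a ξ z = 0 ↔ ∃ w, w ≠ 0 ∧ ratMap r a w = z ∧ ratMap r a w⁻¹ = ξ := by
  obtain ⟨w₁, w₂, w₃, h⟩ := exists_isFiber hr a z
  rw [h.curveF hr]
  constructor
  · intro h0
    rcases mul_eq_zero.1 h0 with h0 | h0
    · rcases mul_eq_zero.1 h0 with h0 | h0
      · exact ⟨w₁, h.ne_zero hr, h.ratMap_eq hr, (sub_eq_zero.1 h0).symm⟩
      · exact ⟨w₂, h.rotate.ne_zero hr, h.rotate.ratMap_eq hr, (sub_eq_zero.1 h0).symm⟩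
    · exact ⟨w₃, h.rotate.rotate.ne_zero hr, h.rotate.rotate.ratMap_eq hr, (sub_eq_zero.1 h0).symm⟩
  · rintro ⟨w, hw, hz, rfl⟩
    rcases (h.ratMap_eq_iff hr hw).1 hz with rfl | rfl | rfl <;> simp

/-! ### Algebra of double points -/

theorem ratMap_sub_ratMap {r a w v : ℂ} (hw : w ≠ 0) (hv : v ≠ 0) :
    ratMap r a w - ratMap r a v =
      (w - v) * (r * ((w * v) ^ 2 - 2 * a * (w * v) - r * (w + v)) / (w * v) ^ 2) := by
  unfold ratMap
  field_simp
  ring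

theorem ratMap_eq_ratMap_iff {r a w v : ℂ} (hr : r ≠ 0) (hw : w ≠ 0) (hv : v ≠ 0) (hwv : w ≠ v) :
    ratMap r a w = ratMap r a v ↔ r * (w + v) = (w * v) ^ 2 - 2 * a * (w * v) := by
  rw [← sub_eq_zero, ratMap_sub_ratMap hw hv, mul_eq_zero_iff_left (sub_ne_zero.2 hwv),
    div_eq_zero_iff, or_iff_left (pow_ne_zero 2 (mul_ne_zero hw hv)), mul_eq_zero_iff_left hr,
    sub_eq_zero, eq_comm]

/-- With P = wv the two coincidences read r(w + v) = P² - 2aP and r(w + v)P = 1 - 2aP; eliminating w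
+ v leaves a cubic in P. -/
theorem node_product {r a w v : ℂ} (hr : r ≠ 0) (hw : w ≠ 0) (hv : v ≠ 0) (hwv : w ≠ v)
    (h : ratMap r a w = ratMap r a v) (h' : ratMap r a w⁻¹ = ratMap r a v⁻¹) :
    (w * v - 1) * ((w * v) ^ 2 + (1 - 2 * a) * (w * v) + 1) = 0 := by
  rw [ratMap_eq_ratMap_iff hr hw hv hwv] at h
  rw [ratMap_eq_ratMap_iff hr (inv_ne_zero hw) (inv_ne_zero hv) (by simpa using hwv)] at h'
  field_simp at h'
  linear_combination (-(w * v)) * h + h'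

theorem ratMap_of_node {r a w v : ℂ} (hr : r ≠ 0) (hw : w ≠ 0) (hv : v ≠ 0) (hwv : w ≠ v)
    (h : ratMap r a w = ratMap r a v)
    (hP : (w * v - 1) * ((w * v) ^ 2 + (1 - 2 * a) * (w * v) + 1) = 0) :
    ratMap r a w = (1 - r ^ 2) * (w * v)⁻¹ - a := by
  rw [ratMap_eq_ratMap_iff hr hw hv hwv] at h
  unfold ratMap
  field_simp
  linear_combination (w * v * w + r) * h + w * hP

theorem inv_of_node {r a w v : ℂ} (hr : r ≠ 0) (hw : w ≠ 0) (hv : v ≠ 0) (hwv : w ≠ v)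
    (h : r * (w + v) = (w * v) ^ 2 - 2 * a * (w * v))
    (hP : (w * v - 1) * ((w * v) ^ 2 + (1 - 2 * a) * (w * v) + 1) = 0) :
    ratMap r a w⁻¹ = ratMap r a v⁻¹ := by
  rw [ratMap_eq_ratMap_iff hr (inv_ne_zero hw) (inv_ne_zero hv) (by simpa using hwv)]
  field_simp
  linear_combination (w * v) * h + hP

/-! ### Univalence outside the disc and the domain Ω -/

theorem rParam_cast_ne_zero {r : ℝ} (hr : 0 < r) : (r : ℂ) ≠ 0 := by exact_mod_cast hr.ne'

/-- A coincidence gives |wv|² ≤ r(|w| + |v|) + 2a|wv| ≤ (2r + 2a)|wv| < |wv|, absurd when |wv| ≥ 1.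
-/
theorem ratMap_inj_of_one_le_norm {r a : ℝ} (hr : 0 < r) (ha : 0 < a) (har : a + r < 1 / 2)
    {w v : ℂ} (hw : 1 ≤ ‖w‖) (hv : 1 ≤ ‖v‖) (h : ratMap r a w = ratMap r a v) : w = v := by
  by_contra hne
  have hw0 : w ≠ 0 := norm_pos_iff.1 (by linarith)
  have hv0 : v ≠ 0 := norm_pos_iff.1 (by linarith)
  rw [ratMap_eq_ratMap_iff (rParam_cast_ne_zero hr) hw0 hv0 hne] at h
  have e : (w * v) ^ 2 = r * (w + v) + 2 * a * (w * v) := by linear_combination -h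
  have h1 : ‖(w * v) ^ 2‖ ≤ r * (‖w‖ + ‖v‖) + 2 * a * (‖w‖ * ‖v‖) := by
    rw [e]
    refine (norm_add_le _ _).trans ?_
    simp only [norm_mul, Complex.norm_real, Real.norm_of_nonneg hr.le, Real.norm_of_nonneg ha.le,
      Complex.norm_ofNat]
    gcongr
    exact norm_add_le _ _
  rw [norm_pow, norm_mul] at h1
  have h2 : ‖w‖ ≤ ‖w‖ * ‖v‖ := le_mul_of_one_le_right (norm_nonneg _) hv
  have h3 : ‖v‖ ≤ ‖w‖ * ‖v‖ := le_mul_of_one_le_left (norm_nonneg _) hw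
  have h4 : 1 ≤ ‖w‖ * ‖v‖ := hw.trans h2
  nlinarith

theorem norm_lt_one_of_critical {r a : ℝ} (hr : 0 < r) (ha : 0 < a) (har : a + r < 1 / 2)
    {w : ℂ} (h : w ^ 3 = 2 * a * w + 2 * r) : ‖w‖ < 1 := by
  by_contra hc
  push Not at hc
  have h1 : ‖w ^ 3‖ ≤ 2 * a * ‖w‖ + 2 * r := by
    rw [h]
    refine (norm_add_le _ _).trans ?_
    simp only [norm_mul, Complex.norm_real, Real.norm_of_nonneg hr.le, Real.norm_of_nonneg ha.le,
      Complex.norm_ofNat]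
    exact le_rfl
  rw [norm_pow] at h1
  have : ‖w‖ ≤ ‖w‖ ^ 3 := le_self_pow₀ hc (by norm_num)
  nlinarith

/-- The image of the open exterior of the unit disc. -/
def exteriorImage (r a : ℂ) : Set ℂ := ratMap r a '' {w | 1 < ‖w‖}

/-- The image of the closed exterior of the unit disc. -/
def closedExteriorImage (r a : ℂ) : Set ℂ := ratMap r a '' {w | 1 ≤ ‖w‖}

theorem closedExteriorImage_eq (r a : ℂ) :
    closedExteriorImage r a = exteriorImage r a ∪ ratMap r a '' Metric.sphere 0 1 := by
  unfold closedExteriorImage exteriorImage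
  rw [← Set.image_union]
  congr 1
  ext w
  simp only [Set.mem_ofPred_eq, Set.mem_union, mem_sphere_iff_norm, sub_zero]
  rw [le_iff_lt_or_eq, eq_comm (a := (1 : ℝ))]

theorem isPreconnected_one_lt_norm : IsPreconnected {w : ℂ | 1 < ‖w‖} := by
  have : {w : ℂ | 1 < ‖w‖} = Complex.exp '' {u | 0 < u.re} := by
    ext w
    constructor
    · intro hw
      have hw' : 1 < ‖w‖ := hw
      refine ⟨Complex.log w, ?_, Complex.exp_log (norm_pos_iff.1 (by linarith))⟩
      change 0 < (Complex.log w).re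
      rw [Complex.log_re]
      exact Real.log_pos hw'
    · rintro ⟨u, hu, rfl⟩
      change 1 < ‖Complex.exp u‖
      rw [Complex.norm_exp]
      exact Real.one_lt_exp_iff.2 hu
  rw [this]
  exact (convex_halfSpace_re_gt 0).isPreconnected.image _ Complex.continuous_exp.continuousOn

theorem analyticAt_ratMap (r a : ℂ) {w : ℂ} (hw : w ≠ 0) : AnalyticAt ℂ (ratMap r a) w := by
  unfold ratMap
  have : w ^ 2 ≠ 0 := pow_ne_zero 2 hw
  fun_prop (disch := assumption)

theorem ne_zero_of_one_le_norm {w : ℂ} (hw : 1 ≤ ‖w‖) : w ≠ 0 := norm_pos_iff.1 (by linarith)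

theorem isOpen_exteriorImage {r a : ℝ} (hr : 0 < r) (ha : 0 < a) (har : a + r < 1 / 2) :
    IsOpen (exteriorImage r a) := by
  have hA : AnalyticOnNhd ℂ (ratMap r a) {w | 1 < ‖w‖} := fun w hw =>
    analyticAt_ratMap _ _ (ne_zero_of_one_le_norm (le_of_lt hw))
  have hO : IsOpen {w : ℂ | 1 < ‖w‖} := isOpen_lt continuous_const continuous_norm
  rcases hA.is_constant_or_isOpen isPreconnected_one_lt_norm with ⟨c, hc⟩ | h
  · have h2 := hc 2 (by simp)
    have h3 := hc 3 (by simp)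
    have := ratMap_inj_of_one_le_norm hr ha har (by simp) (by simp) (h2.trans h3.symm)
    norm_num at this
  · exact h _ subset_rfl hO

theorem isPreconnected_exteriorImage (r a : ℂ) : IsPreconnected (exteriorImage r a) := by
  refine isPreconnected_one_lt_norm.image _ fun w hw => ?_
  exact (analyticAt_ratMap _ _ (ne_zero_of_one_le_norm (le_of_lt hw))).continuousAt.continuousWithinAt

theorem isCompact_boundary (r a : ℂ) : IsCompact (ratMap r a '' Metric.sphere 0 1) := by
  refine (isCompact_sphere _ _).image_of_continuousOn fun w hw => ?_
  refine (analyticAt_ratMap _ _ (ne_zero_of_one_le_norm ?_)).continuousAt.continuousWithinAt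
  simp only [mem_sphere_iff_norm, sub_zero] at hw
  exact hw.ge

/-- Properness: for |w| ≥ 1 the linear term dominates, so bounded values have bounded preimages and
a subsequence converges. -/
theorem isClosed_closedExteriorImage {r a : ℝ} (hr : 0 < r) (ha : 0 < a) :
    IsClosed (closedExteriorImage r a) := by
  apply IsSeqClosed.isClosed
  intro u z hu huz
  choose w hw hwu using hu
  have hwu : ∀ n, ratMap r a (w n) = u n := hwu
  obtain ⟨M, hM⟩ := (Metric.isBounded_range_of_tendsto u huz).exists_norm_le
  have hb : ∀ n, w n ∈ Metric.closedBall (0 : ℂ) ((M + a + 2 * a * r + r ^ 2) / r) := by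
    intro n
    have h1 : 1 ≤ ‖w n‖ := hw n
    have h0 : w n ≠ 0 := ne_zero_of_one_le_norm h1
    rw [mem_closedBall_zero_iff, le_div_iff₀ hr]
    have e : w n * r = u n - a - 2 * a * r / w n - r ^ 2 / w n ^ 2 := by
      rw [← hwu n]; unfold ratMap; ring
    have : ‖w n‖ * r = ‖w n * r‖ := by simp [abs_of_pos hr]
    rw [this, e]
    refine (norm_sub_le _ _).trans (add_le_add ((norm_sub_le _ _).trans (add_le_add
      ((norm_sub_le _ _).trans (add_le_add (hM _ ⟨n, rfl⟩) (le_of_eq ?_))) ?_)) ?_)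
    · simp [abs_of_pos ha]
    · rw [norm_div]
      refine (div_le_self (norm_nonneg _) h1).trans_eq ?_
      simp [abs_of_pos hr, abs_of_pos ha]
    · rw [norm_div, norm_pow (w n)]
      refine (div_le_self (norm_nonneg _) (one_le_pow₀ h1)).trans_eq ?_
      simp
  obtain ⟨w', -, φ, hφ, hlim⟩ := tendsto_subseq_of_bounded Metric.isBounded_closedBall hb
  have hw' : 1 ≤ ‖w'‖ := ge_of_tendsto' hlim.norm fun n => (hw (φ n) : 1 ≤ ‖w (φ n)‖)
  refine ⟨w', hw', ?_⟩
  have h1 := (analyticAt_ratMap r a (ne_zero_of_one_le_norm hw')).continuousAt.tendsto.comp hlim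
  have h2 := huz.comp hφ.tendsto_atTop
  refine tendsto_nhds_unique h1 (h2.congr fun n => ?_)
  simp [hwu]

theorem isBounded_compl_closedExteriorImage {r : ℝ} (hr : 0 < r) (a : ℂ) :
    Bornology.IsBounded (closedExteriorImage r a)ᶜ := by
  refine isBounded_iff_forall_norm_le.2 ⟨‖a‖ + r * (1 + 1 + 1), fun z hz => ?_⟩
  obtain ⟨w₁, w₂, w₃, h⟩ := exists_isFiber (rParam_cast_ne_zero hr) a z
  have key : ∀ {w₁ w₂ w₃}, IsFiber r a z w₁ w₂ w₃ → ‖w₁‖ ≤ 1 := fun h => by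
    by_contra hc
    push Not at hc
    exact hz ⟨_, hc.le, h.ratMap_eq (rParam_cast_ne_zero hr)⟩
  rw [← h.1]
  refine norm_add_le_of_le le_rfl ?_
  rw [norm_mul, Complex.norm_real, Real.norm_of_nonneg hr.le]
  gcongr
  exact norm_add_le_of_le (norm_add_le_of_le (key h) (key h.rotate)) (key h.rotate.rotate)

theorem hMap_paramT {r a : ℝ} (hr : 0 < r) (ha : 0 < a) (har : a + r < 1 / 2) :
    hMap (paramT0 r a) (paramT1 r a) = ratMap r a := by
  funext w
  unfold hMap ratMap
  rw [rParam_paramT hr ha har, aParam_paramT hr ha har]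

theorem boundaryCurve_paramT {r a : ℝ} (hr : 0 < r) (ha : 0 < a) (har : a + r < 1 / 2) :
    boundaryCurve (paramT0 r a) (paramT1 r a) = ratMap r a '' Metric.sphere 0 1 := by
  unfold boundaryCurve
  rw [hMap_paramT hr ha har]

theorem exteriorImage_subset {r a : ℝ} (hr : 0 < r) (ha : 0 < a) (har : a + r < 1 / 2) :
    exteriorImage r a ⊆ (ratMap r a '' Metric.sphere 0 1)ᶜ := by
  rintro _ ⟨w, hw, rfl⟩ ⟨v, hv, h⟩
  simp only [mem_sphere_iff_norm, sub_zero] at hv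
  have hw' : 1 < ‖w‖ := hw
  have := ratMap_inj_of_one_le_norm hr ha har hv.ge hw'.le h
  rw [this] at hv
  linarith

/-- The exterior image is connected and avoids the curve, so meeting a bounded component would make
it bounded, and with it the whole plane. -/
theorem exteriorImage_disjoint_Omega {r a : ℝ} (hr : 0 < r) (ha : 0 < a) (har : a + r < 1 / 2) :
    Disjoint (exteriorImage r a) (Omega (paramT0 r a) (paramT1 r a)) := by
  rw [Set.disjoint_left]
  rintro z hz ⟨-, hb⟩
  rw [boundaryCurve_paramT hr ha har] at hb
  have hE : Bornology.IsBounded (exteriorImage r a) := hb.subset <|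
    (isPreconnected_exteriorImage r a).subset_connectedComponentIn hz
      (exteriorImage_subset hr ha har)
  apply NormedSpace.unbounded_univ ℝ ℂ
  rw [← Set.union_compl_self (closedExteriorImage r a)]
  refine Bornology.IsBounded.union ?_ (isBounded_compl_closedExteriorImage hr a)
  rw [closedExteriorImage_eq]
  exact hE.union (isCompact_boundary r a).isBounded

theorem ratMap_not_mem_closure_Omega {r a : ℝ} (hr : 0 < r) (ha : 0 < a) (har : a + r < 1 / 2)
    {w : ℂ} (hw : 1 < ‖w‖) : ratMap r a w ∉ closure (Omega (paramT0 r a) (paramT1 r a)) := by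
  have := (exteriorImage_disjoint_Omega hr ha har).closure_right (isOpen_exteriorImage hr ha har)
  exact Set.disjoint_left.1 this ⟨w, hw, rfl⟩

/-- Off the curve the plane splits into two disjoint open sets, the exterior image and the bounded
complement of the closed one; a component stays in one of them. -/
theorem mem_Omega_of_not_mem {r a : ℝ} (hr : 0 < r) (ha : 0 < a) (har : a + r < 1 / 2)
    {z : ℂ} (hz : z ∉ closedExteriorImage r a) : z ∈ Omega (paramT0 r a) (paramT1 r a) := by
  unfold Omega
  rw [boundaryCurve_paramT hr ha har]
  have hz' : z ∈ (ratMap r a '' Metric.sphere 0 1)ᶜ := fun h =>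
    hz (closedExteriorImage_eq r a ▸ Or.inr h)
  refine ⟨hz', (isBounded_compl_closedExteriorImage hr a).subset ?_⟩
  refine isPreconnected_connectedComponentIn.subset_left_of_subset_union
    (isClosed_closedExteriorImage hr ha).isOpen_compl (isOpen_exteriorImage hr ha har) ?_ ?_
    ⟨z, mem_connectedComponentIn hz', hz⟩
  · rw [closedExteriorImage_eq]
    exact Set.disjoint_left.2 fun x hx hx' => hx (Or.inl hx')
  · refine (connectedComponentIn_subset _ _).trans fun x hx => ?_
    by_cases h : x ∈ exteriorImage r a
    · exact Or.inr h
    · refine Or.inl fun h' => ?_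
      rw [closedExteriorImage_eq] at h'
      exact h'.elim h hx

theorem IsFiber.mem_Omega {r a : ℝ} (hr : 0 < r) (ha : 0 < a) (har : a + r < 1 / 2)
    {z w₁ w₂ w₃ : ℂ} (h : IsFiber r a z w₁ w₂ w₃) (h1 : ‖w₁‖ < 1) (h2 : ‖w₂‖ < 1)
    (h3 : ‖w₃‖ < 1) : z ∈ Omega (paramT0 r a) (paramT1 r a) := by
  refine mem_Omega_of_not_mem hr ha har ?_
  rintro ⟨w, hw, hz⟩
  have hw' : 1 ≤ ‖w‖ := hw
  rcases (h.ratMap_eq_iff (rParam_cast_ne_zero hr) (ne_zero_of_one_le_norm hw')).1 hz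
    with rfl | rfl | rfl <;> linarith

theorem spectralF_paramT {r a : ℝ} (hr : 0 < r) (ha : 0 < a) (har : a + r < 1 / 2) :
    spectralF (paramT0 r a) (paramT1 r a) = curveF r a := by
  funext ξ z
  unfold spectralF coeffA coeffB curveF
  rw [rParam_paramT hr ha har, aParam_paramT hr ha har]
  unfold formA formB paramT0 paramT1
  push_cast
  ring

/-! ### Critical points of the curve are its nodes -/

/-- The data of a double point of the parametrized curve. -/
def IsNode (r a ξ z w v : ℂ) : Prop :=
  w ≠ 0 ∧ v ≠ 0 ∧ w ≠ v ∧ ratMap r a w = z ∧ ratMap r a v = z ∧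
    ratMap r a w⁻¹ = ξ ∧ ratMap r a v⁻¹ = ξ

theorem IsFiber.deriv_curveF {r a z w₁ w₂ w₃ : ℂ} (h : IsFiber r a z w₁ w₂ w₃) (hr : r ≠ 0)
    (ξ : ℂ) : deriv (fun x => CubicModel.curveF r a x z) ξ =
      (ξ - ratMap r a w₁⁻¹) * (ξ - ratMap r a w₂⁻¹) + (ξ - ratMap r a w₁⁻¹) * (ξ - ratMap r a w₃⁻¹)
        + (ξ - ratMap r a w₂⁻¹) * (ξ - ratMap r a w₃⁻¹) := by
  simp_rw [h.curveF hr]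
  have h1 := (hasDerivAt_id' ξ).sub_const (ratMap r a w₁⁻¹)
  have h2 := (hasDerivAt_id' ξ).sub_const (ratMap r a w₂⁻¹)
  have h3 := (hasDerivAt_id' ξ).sub_const (ratMap r a w₃⁻¹)
  refine ((h1.mul h2).mul h3).deriv.trans ?_
  simp only [Pi.mul_apply]
  ring

theorem IsFiber.critical {r a z w w₃ : ℂ} (h : IsFiber r a z w w w₃) :
    w ^ 3 = 2 * a * w + 2 * r := by
  linear_combination w * h.2.1 - 2 * h.2.2

theorem IsFiber.node_or_critical {r a z w₁ w₂ w₃ ξ : ℂ} (h : IsFiber r a z w₁ w₂ w₃) (hr : r ≠ 0)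
    (h1 : ratMap r a w₁⁻¹ = ξ) (h2 : ratMap r a w₂⁻¹ = ξ) :
    (∃ w v, IsNode r a ξ z w v) ∨
      ∃ w, w ≠ 0 ∧ ratMap r a w = z ∧ ratMap r a w⁻¹ = ξ ∧ w ^ 3 = 2 * a * w + 2 * r := by
  by_cases hw : w₁ = w₂
  · subst hw
    exact Or.inr ⟨w₁, h.ne_zero hr, h.ratMap_eq hr, h1, h.critical⟩
  · exact Or.inl ⟨w₁, w₂, h.ne_zero hr, h.rotate.ne_zero hr, hw, h.ratMap_eq hr,
      h.rotate.ratMap_eq hr, h1, h2⟩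

/-- A double root ξ of the fibre polynomial comes from two indices: distinct wᵢ form a node, a
repeated one is a ramification point of h. -/
theorem node_or_critical {r a ξ z : ℂ} (hr : r ≠ 0) (h0 : curveF r a ξ z = 0)
    (hd : deriv (fun x => curveF r a x z) ξ = 0) :
    (∃ w v, IsNode r a ξ z w v) ∨
      ∃ w, w ≠ 0 ∧ ratMap r a w = z ∧ ratMap r a w⁻¹ = ξ ∧ w ^ 3 = 2 * a * w + 2 * r := by
  obtain ⟨w₁, w₂, w₃, h⟩ := exists_isFiber hr a z
  rw [h.deriv_curveF hr] at hd
  rw [h.curveF hr] at h0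
  by_cases e1 : ξ - ratMap r a w₁⁻¹ = 0
  · rw [e1] at hd
    have : (ξ - ratMap r a w₂⁻¹) * (ξ - ratMap r a w₃⁻¹) = 0 := by linear_combination hd
    rcases mul_eq_zero.1 this with e | e
    · exact h.node_or_critical hr (sub_eq_zero.1 e1).symm (sub_eq_zero.1 e).symm
    · exact h.rotate.rotate.node_or_critical hr (sub_eq_zero.1 e).symm (sub_eq_zero.1 e1).symm
  · by_cases e2 : ξ - ratMap r a w₂⁻¹ = 0
    · rw [e2] at hd
      have : (ξ - ratMap r a w₁⁻¹) * (ξ - ratMap r a w₃⁻¹) = 0 := by linear_combination hd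
      have e := (mul_eq_zero.1 this).resolve_left e1
      exact h.rotate.node_or_critical hr (sub_eq_zero.1 e2).symm (sub_eq_zero.1 e).symm
    · have e := (mul_eq_zero.1 h0).resolve_left (mul_ne_zero e1 e2)
      rw [e] at hd
      have : (ξ - ratMap r a w₁⁻¹) * (ξ - ratMap r a w₂⁻¹) = 0 := by linear_combination hd
      exact absurd this (mul_ne_zero e1 e2)

theorem IsNode.swap {r a ξ z w v : ℂ} (h : IsNode r a ξ z w v) : IsNode r a z ξ w⁻¹ v⁻¹ := by
  obtain ⟨h1, h2, h3, h4, h5, h6, h7⟩ := h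
  exact ⟨inv_ne_zero h1, inv_ne_zero h2, by simpa using h3, h6, h7, by simpa using h4,
    by simpa using h5⟩

theorem IsNode.deriv_eq_zero {r a ξ z w v : ℂ} (h : IsNode r a ξ z w v) (hr : r ≠ 0) :
    curveF r a ξ z = 0 ∧ deriv (fun x => curveF r a x z) ξ = 0 := by
  obtain ⟨h1, h2, h3, h4, h5, h6, h7⟩ := h
  obtain ⟨w₁, w₂, w₃, h⟩ := exists_isFiber hr a z
  rw [h.deriv_curveF hr, h.curveF hr, ← sub_eq_zero.2 h6.symm]
  have h76 := h7.trans h6.symm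
  rcases (h.ratMap_eq_iff hr h1).1 h4 with rfl | rfl | rfl <;>
  rcases (h.ratMap_eq_iff hr h2).1 h5 with rfl | rfl | rfl <;>
  first
  | exact absurd rfl h3
  | (rw [h76, h6]; simp)

/-- If both projections only show ramification, at w and at v⁻¹ respectively, then |w| < 1 < |v⁻¹|,
so these are different parameters over the same point: again a node. -/
theorem isCriticalPoint_iff_node {r a : ℝ} (hr : 0 < r) (ha : 0 < a) (har : a + r < 1 / 2)
    {z : ℂ} : IsCriticalPoint (curveF r a) z ↔ ∃ ξ w v, IsNode r a ξ z w v := by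
  have hr0 := rParam_cast_ne_zero hr
  constructor
  · rintro ⟨ξ, h0, h1, h2⟩
    refine ⟨ξ, ?_⟩
    rcases node_or_critical hr0 h0 h1 with h | ⟨w, hw, hz, hξ, hc⟩
    · exact h
    simp_rw [curveF_symm _ _ ξ] at h2
    rw [curveF_symm] at h0
    rcases node_or_critical hr0 h0 h2 with ⟨v, v', h⟩ | ⟨v, hv, hz', hξ', hc'⟩
    · exact ⟨_, _, h.swap⟩
    · refine ⟨w, v⁻¹, hw, inv_ne_zero hv, ?_, hz, hξ', hξ, by simpa using hz'⟩
      rintro rfl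
      have h1 := norm_lt_one_of_critical hr ha har hc
      have h2 := norm_lt_one_of_critical hr ha har hc'
      rw [norm_inv] at h1
      exact absurd ((one_lt_inv₀ (norm_pos_iff.2 hv)).2 h2) h1.not_gt
  · rintro ⟨ξ, w, v, h⟩
    refine ⟨ξ, (h.deriv_eq_zero hr0).1, (h.deriv_eq_zero hr0).2, ?_⟩
    simp_rw [curveF_symm _ _ ξ]
    exact (h.swap.deriv_eq_zero hr0).2

/-- The value of `w v` at one of the two non-real nodes. -/
def nodeProduct (a : ℝ) : ℂ := ⟨(2 * a - 1) / 2, Real.sqrt (4 - (2 * a - 1) ^ 2) / 2⟩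

theorem nodeProduct_sq {a : ℝ} (ha : 0 < a) (ha2 : a < 1 / 2) :
    nodeProduct a * (starRingEnd ℂ) (nodeProduct a) = 1 ∧
      nodeProduct a + (starRingEnd ℂ) (nodeProduct a) = 2 * a - 1 ∧ 0 < (nodeProduct a).im := by
  have h4 : 0 < 4 - (2 * a - 1) ^ 2 := by nlinarith
  have hs := Real.mul_self_sqrt h4.le
  refine ⟨?_, ?_, by unfold nodeProduct; positivity⟩
  · apply Complex.ext
    · simp only [nodeProduct, Complex.mul_re, Complex.conj_re, Complex.conj_im, Complex.one_re]
      linear_combination hs / 4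
    · simp only [nodeProduct, Complex.mul_im, Complex.conj_re, Complex.conj_im, Complex.one_im]
      ring
  · apply Complex.ext <;> simp [nodeProduct]

theorem node_cubic_iff {a : ℝ} (ha : 0 < a) (ha2 : a < 1 / 2) (P : ℂ) :
    (P - 1) * (P ^ 2 + (1 - 2 * a) * P + 1) = 0 ↔
      P = 1 ∨ P = nodeProduct a ∨ P = (starRingEnd ℂ) (nodeProduct a) := by
  obtain ⟨h1, h2, -⟩ := nodeProduct_sq ha ha2
  have : P ^ 2 + (1 - 2 * a) * P + 1 =
      (P - nodeProduct a) * (P - (starRingEnd ℂ) (nodeProduct a)) := by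
    linear_combination P * h2 - h1
  rw [this, mul_eq_zero, mul_eq_zero, sub_eq_zero, sub_eq_zero, sub_eq_zero]

/-- The roots of X² - SX + P are Sμ and S(1 - μ) with μ real and κμ(1 - μ) = 1; as |S| = √κ > 2, the
one with μ > 1/2 lies outside the disc. -/
theorem exists_factor {P S : ℂ} {κ : ℝ} (hP : ‖P‖ = 1) (hκ : 4 < κ) (hS : S ^ 2 = κ * P) :
    ∃ w, 1 < ‖w‖ ∧ w * (S - w) = P := by
  have hpos : 0 < 1 - 4 / κ := by
    rw [sub_pos, div_lt_one (by linarith)]; exact hκ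
  set μ := (1 + Real.sqrt (1 - 4 / κ)) / 2 with hμ
  have hμ1 : 1 / 2 < μ := by have := Real.sqrt_pos.2 hpos; rw [hμ]; linarith
  have hμ2 : κ * (μ * (1 - μ)) = 1 := by
    have := Real.mul_self_sqrt hpos.le
    have e : μ * (1 - μ) = 1 / κ := by rw [hμ]; linear_combination (-1 / 4) * this
    rw [e]; field_simp
  refine ⟨S * μ, ?_, ?_⟩
  · have hS2 : ‖S‖ ^ 2 = κ := by
      rw [← norm_pow, hS, norm_mul, hP, Complex.norm_real, Real.norm_of_nonneg (by linarith),
        mul_one]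
    have : 2 < ‖S‖ := by
      by_contra hc
      push Not at hc
      nlinarith [norm_nonneg S]
    rw [norm_mul, Complex.norm_real, Real.norm_of_nonneg (by linarith)]
    nlinarith
  · have : (κ : ℂ) * (μ * (1 - μ)) = 1 := by exact_mod_cast hμ2
    linear_combination (μ * (1 - μ) : ℂ) * hS + P * this

theorem exists_node {r a : ℝ} (hr : 0 < r) (ha : 0 < a) (har : a + r < 1 / 2) {P : ℂ}
    (hP : (P - 1) * (P ^ 2 + (1 - 2 * a) * P + 1) = 0) :
    ∃ w v, IsNode r a ((1 - r ^ 2) * P - a) ((1 - r ^ 2) * P⁻¹ - a) w v ∧ 1 < ‖w‖ := by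
  have hr0 := rParam_cast_ne_zero hr
  have hP1 : ‖P‖ = 1 := by
    obtain ⟨h1, -, -⟩ := nodeProduct_sq ha (by linarith)
    have : ‖nodeProduct a‖ = 1 := by
      have := congrArg norm h1
      rw [norm_mul, Complex.norm_conj, norm_one] at this
      nlinarith [norm_nonneg (nodeProduct a)]
    rcases (node_cubic_iff ha (by linarith) P).1 hP with rfl | rfl | rfl
    · simp
    · exact this
    · rw [Complex.norm_conj]; exact this
  have hP0 : P ≠ 0 := by rintro rfl; simp at hP1
  set S : ℂ := (P ^ 2 - 2 * a * P) / r with hSdef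
  have hrS : r * S = P ^ 2 - 2 * a * P := by rw [hSdef]; field_simp
  -- S is the required sum w + v. For P = 1 the ratio κ is immediate; for the other roots P(P - 2a)²
  -- = 1 + 2a.
  obtain ⟨κ, hκ, hS⟩ : ∃ κ : ℝ, 4 < κ ∧ S ^ 2 = κ * P := by
    rcases mul_eq_zero.1 hP with h | h
    · refine ⟨(1 - 2 * a) ^ 2 / r ^ 2, ?_, ?_⟩
      · rw [lt_div_iff₀ (by positivity)]; nlinarith
      · obtain rfl := sub_eq_zero.1 h
        rw [hSdef]; push_cast; field_simp
    · refine ⟨(1 + 2 * a) / r ^ 2, ?_, ?_⟩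
      · rw [lt_div_iff₀ (by positivity)]; nlinarith
      · rw [hSdef]; push_cast; field_simp
        linear_combination (P - 2 * a - 1) * h
  obtain ⟨w, hw, hwS⟩ := exists_factor hP1 hκ hS
  have hw0 : w ≠ 0 := ne_zero_of_one_le_norm hw.le
  have hv0 : S - w ≠ 0 := by
    intro h; rw [h, mul_zero] at hwS; exact hP0 hwS.symm
  have hwv : w ≠ S - w := by
    intro h
    have h1 : ‖w‖ * ‖S - w‖ = 1 := by rw [← norm_mul, hwS, hP1]
    rw [← h] at h1
    nlinarith
  have hsum : (r : ℂ) * (w + (S - w)) = (w * (S - w)) ^ 2 - 2 * a * (w * (S - w)) := by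
    rw [hwS]; linear_combination hrS
  have hP' : (w * (S - w) - 1) * ((w * (S - w)) ^ 2 + (1 - 2 * a) * (w * (S - w)) + 1) = 0 := by
    rw [hwS]; exact hP
  have hz := (ratMap_eq_ratMap_iff hr0 hw0 hv0 hwv).2 hsum
  have hz' := ratMap_of_node hr0 hw0 hv0 hwv hz hP'
  have hx := inv_of_node hr0 hw0 hv0 hwv hsum hP'
  have hx' : ratMap r a w⁻¹ = (1 - r ^ 2) * P - a := by
    have := ratMap_of_node hr0 (inv_ne_zero hw0) (inv_ne_zero hv0) (by simpa using hwv) hx (by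
      rw [← mul_inv, hwS]
      field_simp
      linear_combination -hP)
    rw [this, ← mul_inv, hwS, inv_inv]
  rw [hwS] at hz'
  refine ⟨w, S - w, ⟨hw0, hv0, hwv, hz', hz ▸ hz', hx', hx ▸ hx'⟩, hw⟩

theorem isCriticalPoint_iff {r a : ℝ} (hr : 0 < r) (ha : 0 < a) (har : a + r < 1 / 2)
    {z : ℂ} : IsCriticalPoint (curveF r a) z ↔
      ∃ P : ℂ, (P - 1) * (P ^ 2 + (1 - 2 * a) * P + 1) = 0 ∧ z = (1 - r ^ 2) * P⁻¹ - a := by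
  have hr0 := rParam_cast_ne_zero hr
  rw [isCriticalPoint_iff_node hr ha har]
  constructor
  · rintro ⟨ξ, w, v, h1, h2, h3, h4, h5, h6, h7⟩
    have hP := node_product hr0 h1 h2 h3 (h4.trans h5.symm) (h6.trans h7.symm)
    exact ⟨w * v, hP, h4 ▸ ratMap_of_node hr0 h1 h2 h3 (h4.trans h5.symm) hP⟩
  · rintro ⟨P, hP, rfl⟩
    obtain ⟨w, v, h, -⟩ := exists_node hr ha har hP
    exact ⟨_, w, v, h⟩

theorem IsCriticalPoint.not_mem_closure {r a : ℝ} (hr : 0 < r) (ha : 0 < a)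
    (har : a + r < 1 / 2) {z : ℂ} (h : IsCriticalPoint (curveF r a) z) :
    z ∉ closure (Omega (paramT0 r a) (paramT1 r a)) := by
  obtain ⟨P, hP, rfl⟩ := (isCriticalPoint_iff hr ha har).1 h
  obtain ⟨w, v, h, hw⟩ := exists_node hr ha har hP
  rw [← h.2.2.2.1]
  exact ratMap_not_mem_closure_Omega hr ha har hw

theorem isCriticalPoint_iff_eq {r a : ℝ} (hr : 0 < r) (ha : 0 < a) (har : a + r < 1 / 2)
    {z : ℂ} : IsCriticalPoint (curveF r a) z ↔ z = ((1 - a - r ^ 2 : ℝ) : ℂ) ∨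
      z = (1 - r ^ 2) * (starRingEnd ℂ) (nodeProduct a) - a ∨
      z = (1 - r ^ 2) * nodeProduct a - a := by
  rw [isCriticalPoint_iff hr ha har]
  simp_rw [node_cubic_iff ha (by linarith : a < 1 / 2)]
  have h1 := (nodeProduct_sq ha (by linarith : a < 1 / 2)).1
  have e1 := inv_eq_of_mul_eq_one_right h1
  have e2 := inv_eq_of_mul_eq_one_left h1
  constructor
  · rintro ⟨P, rfl | rfl | rfl, rfl⟩
    · left; push_cast; ring
    · right; left; rw [e1]
    · right; right; rw [e2]
  · rintro (rfl | rfl | rfl)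
    · exact ⟨1, by simp, by push_cast; ring⟩
    · exact ⟨nodeProduct a, by simp, by rw [e1]⟩
    · exact ⟨(starRingEnd ℂ) (nodeProduct a), by simp, by rw [e2]⟩

/-! ### Local uniformizers and orders of vanishing -/

/-- ψ is the local inverse of (w - w₀)·g^(1/k). Normalizing g by its value at w₀ keeps the root away
from the branch cut. -/
theorem exists_pow_uniformizer {g : ℂ → ℂ} {w₀ : ℂ} {k : ℕ} (hk : 0 < k)
    (hg : AnalyticAt ℂ g w₀) (hg0 : g w₀ ≠ 0) :
    ∃ ψ : ℂ → ℂ, AnalyticAt ℂ ψ 0 ∧ ψ 0 = w₀ ∧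
      (∀ᶠ τ in 𝓝 0, (ψ τ - w₀) ^ k * g (ψ τ) = τ ^ k) ∧ ∃ U ∈ 𝓝 (0 : ℂ), Set.InjOn ψ U := by
  obtain ⟨d, hd⟩ := IsAlgClosed.exists_pow_nat_eq (g w₀) hk
  have hd0 : d ≠ 0 := by rintro rfl; rw [zero_pow hk.ne'] at hd; exact hg0 hd.symm
  set q : ℂ → ℂ := fun w => d * (g w / g w₀) ^ ((k : ℂ)⁻¹) with hq
  have hqa : AnalyticAt ℂ q w₀ := by
    refine analyticAt_const.mul (AnalyticAt.cpow (hg.div analyticAt_const hg0) analyticAt_const ?_)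
    rw [div_self hg0]
    exact Complex.one_mem_slitPlane
  have hq0 : q w₀ = d := by simp [hq, div_self hg0]
  have hqk : ∀ w, q w ^ k = g w := fun w => by
    rw [hq]
    simp only
    rw [mul_pow, Complex.cpow_nat_inv_pow _ hk.ne', hd]
    field_simp
  have hχ : AnalyticAt ℂ (fun w => (w - w₀) * q w) w₀ := by fun_prop
  have hder : deriv (fun w => (w - w₀) * q w) w₀ = d := by
    have := ((hasDerivAt_id' w₀).sub_const w₀).mul hqa.differentiableAt.hasDerivAt
    refine this.deriv.trans ?_
    simp [hq0]
  have hder0 : deriv (fun w => (w - w₀) * q w) w₀ ≠ 0 := by rw [hder]; exact hd0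
  have hχ0 : (w₀ - w₀) * q w₀ = 0 := by simp
  have h1 := hχ.analyticAt_localInverse hder0
  have h2 := hχ.hasStrictDerivAt.eventually_right_inverse hder0
  have h3 := hχ.hasStrictDerivAt.eventually_left_inverse hder0
  set ψ := hχ.hasStrictDerivAt.localInverse _ _ _ hder0 with hψ
  have h4 := h3.self_of_nhds
  rw [hχ0] at h1 h2 h4
  refine ⟨ψ, h1, h4, ?_, _, h2, ?_⟩
  · filter_upwards [h2] with τ hτ
    rw [← hqk, ← mul_pow]
    exact congrArg (· ^ k) hτ
  · intro x hx y hy hxy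
    have hx' : (ψ x - w₀) * q (ψ x) = x := hx
    have hy' : (ψ y - w₀) * q (ψ y) = y := hy
    rw [← hx', ← hy', hxy]

/-- Injectivity forces order one. A constant germ agrees at τ and τ/2; at order n ≥ 2 a uniformizer
turns f into f(0) + τⁿ, which is invariant under an n-th root of unity. -/
theorem exists_simple_factor_of_injOn {f : ℂ → ℂ} (hf : AnalyticAt ℂ f 0) {U : Set ℂ}
    (hU : U ∈ 𝓝[≠] (0 : ℂ)) (hinj : Set.InjOn f U) :
    ∃ q : ℂ → ℂ, AnalyticAt ℂ q 0 ∧ q 0 ≠ 0 ∧ ∀ᶠ τ in 𝓝 0, f τ - f 0 = τ * q τ := by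
  have hfs : AnalyticAt ℂ (fun τ => f τ - f 0) 0 := by fun_prop
  rcases h : analyticOrderAt (fun τ => f τ - f 0) 0 with _ | n
  · exfalso
    have h0 : ∀ᶠ τ in 𝓝[≠] (0 : ℂ), f τ = f 0 := by
      refine (analyticOrderAt_eq_top.1 h).filter_mono nhdsWithin_le_nhds |>.mono fun τ hτ => ?_
      exact sub_eq_zero.1 hτ
    have h2 : Filter.Tendsto (fun τ : ℂ => 2⁻¹ * τ) (𝓝[≠] 0) (𝓝[≠] 0) := by
      refine tendsto_nhdsWithin_iff.2 ⟨?_, ?_⟩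
      · have : ContinuousAt (fun τ : ℂ => 2⁻¹ * τ) 0 := by fun_prop
        have := this.tendsto
        rw [mul_zero] at this
        exact this.mono_left nhdsWithin_le_nhds
      · filter_upwards [self_mem_nhdsWithin] with τ hτ
        have : τ ≠ 0 := hτ
        simpa using this
    obtain ⟨τ, h1, h3, h4, h5, h6⟩ :=
      (h0.and ((h2.eventually h0).and ((h2.eventually hU).and
        (Filter.Eventually.and hU self_mem_nhdsWithin)))).exists
    have := hinj h4 h5 (h3.trans h1.symm)
    have h6 : τ ≠ 0 := h6
    apply h6
    linear_combination (-2 : ℂ) * this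
  · change analyticOrderAt (fun τ => f τ - f 0) 0 = (n : ℕ∞) at h
    obtain ⟨g, hg, hg0, hfg⟩ := hfs.analyticOrderAt_eq_natCast.1 h
    simp only [sub_zero, smul_eq_mul] at hfg
    rcases Nat.lt_or_ge 1 n with hn | hn
    · exfalso
      obtain ⟨ψ, hψ, hψ0, hψn, V, hV, hVinj⟩ := exists_pow_uniformizer (k := n) (by omega) hg hg0
      set ζ := Complex.exp (2 * Real.pi * Complex.I / n) with hζ
      have hprim : IsPrimitiveRoot ζ n := Complex.isPrimitiveRoot_exp n (by omega)
      have hζ0 : ζ ≠ 0 := Complex.exp_ne_zero _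
      have hψt : Filter.Tendsto ψ (𝓝[≠] 0) (𝓝[≠] 0) := by
        refine tendsto_nhdsWithin_iff.2 ⟨?_, ?_⟩
        · have := hψ.continuousAt.tendsto
          rw [hψ0] at this
          exact this.mono_left nhdsWithin_le_nhds
        · filter_upwards [hψn.filter_mono nhdsWithin_le_nhds, self_mem_nhdsWithin] with τ h1 h2 h3
          have h2 : τ ≠ 0 := h2
          have h3 : ψ τ = 0 := h3
          rw [h3, sub_zero, zero_pow (by omega), zero_mul] at h1
          exact pow_ne_zero n h2 h1.symm
      have hm : Filter.Tendsto (fun τ : ℂ => ζ * τ) (𝓝[≠] 0) (𝓝[≠] 0) := by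
        refine tendsto_nhdsWithin_iff.2 ⟨?_, ?_⟩
        · have : ContinuousAt (fun τ : ℂ => ζ * τ) 0 := by fun_prop
          have := this.tendsto
          rw [mul_zero] at this
          exact this.mono_left nhdsWithin_le_nhds
        · filter_upwards [self_mem_nhdsWithin] with τ hτ
          exact mul_ne_zero hζ0 hτ
      have hgood : ∀ᶠ τ in 𝓝[≠] (0 : ℂ), ψ τ ∈ U ∧ τ ∈ V ∧ f (ψ τ) = f 0 + τ ^ n := by
        filter_upwards [hψt.eventually hU, nhdsWithin_le_nhds hV,
          hψn.filter_mono nhdsWithin_le_nhds,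
          hψt.eventually (hfg.filter_mono nhdsWithin_le_nhds)] with τ h1 h2 h3 h4
        refine ⟨h1, h2, ?_⟩
        rw [sub_zero] at h3
        rw [← h3, ← h4]; ring
      obtain ⟨τ, ⟨h1, h2, h3⟩, ⟨h4, h5, h6⟩, h7⟩ :=
        (hgood.and ((hm.eventually hgood).and self_mem_nhdsWithin)).exists
      have h7 : τ ≠ 0 := h7
      have e := hVinj h5 h2 (hinj h4 h1 (by rw [h6, h3, mul_pow, hprim.pow_eq_one, one_mul]))
      exact hprim.ne_one hn (mul_right_cancel₀ h7 (e.trans (one_mul τ).symm))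
    · interval_cases n
      · have := hfg.self_of_nhds
        rw [sub_self, pow_zero, one_mul] at this
        exact absurd this.symm hg0
      · exact ⟨g, hg, hg0, by simpa using hfg⟩

theorem pow_exponent_unique {u v : ℂ → ℂ} {m k : ℕ} (hu : ContinuousAt u 0)
    (hv : ContinuousAt v 0) (hu0 : u 0 ≠ 0) (hv0 : v 0 ≠ 0)
    (h : ∀ᶠ τ in 𝓝[≠] (0 : ℂ), τ ^ m * u τ = τ ^ k * v τ) : m = k := by
  have key : ∀ {u v : ℂ → ℂ} {m k : ℕ}, ContinuousAt u 0 → ContinuousAt v 0 → u 0 ≠ 0 →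
      (∀ᶠ τ in 𝓝[≠] (0 : ℂ), τ ^ m * u τ = τ ^ k * v τ) → ¬ m < k := by
    intro u v m k hu hv hu0 h hmk
    obtain ⟨j, rfl⟩ := Nat.exists_eq_add_of_lt hmk
    have h1 : u =ᶠ[𝓝[≠] 0] fun τ => τ ^ (j + 1) * v τ := by
      filter_upwards [h, self_mem_nhdsWithin] with τ hτ hτ0
      have hτ0 : τ ≠ 0 := hτ0
      apply mul_left_cancel₀ (pow_ne_zero m hτ0)
      rw [hτ]; ring
    have h2 : ContinuousAt (fun τ => τ ^ (j + 1) * v τ) 0 := by fun_prop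
    have := ((hu.eventuallyEq_nhds_iff_eventuallyEq_nhdsNE h2).1 h1).self_of_nhds
    simp at this
    exact hu0 this
  rcases lt_trichotomy m k with hc | hc | hc
  · exact absurd hc (key hu hv hu0 h)
  · exact hc
  · exact absurd hc (key hv hu hv0 (h.mono fun _ => Eq.symm))

/-! ### Lifting Puiseux germs and finding the branch points -/

/-- The equations `ratMap r a w = z` and `ratMap r a w⁻¹ = ξ` determine `w` rationally. -/
theorem param_linear {r a w z ξ : ℂ} (hw : w ≠ 0) (hz : ratMap r a w = z)
    (hξ : ratMap r a w⁻¹ = ξ) :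
    ((1 - r ^ 2) * (2 * a * r ^ 2 - a + ξ) + (a + z) * (a - z - 2 * a * r ^ 2)) * w =
      r * ((1 - r ^ 2) ^ 2 - (a + z) * (a + ξ)) := by
  rw [← hz, ← hξ]
  unfold ratMap
  field_simp
  ring

theorem isCriticalPoint_of_param_linear_degenerate {r a : ℝ} (hr : 0 < r) (ha : 0 < a)
    (har : a + r < 1 / 2) {z ξ : ℂ}
    (hD : (1 - (r : ℂ) ^ 2) * (2 * a * r ^ 2 - a + ξ) + (a + z) * (a - z - 2 * a * r ^ 2) = 0)
    (hN : (1 - (r : ℂ) ^ 2) ^ 2 - (a + z) * (a + ξ) = 0) :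
    IsCriticalPoint (curveF r a) z := by
  have hc : (1 - (r : ℂ) ^ 2) ≠ 0 := by
    have : (1 - r ^ 2) ≠ 0 := by nlinarith
    exact_mod_cast this
  have hy : (a : ℂ) + z ≠ 0 := by
    intro h
    rw [h, zero_mul, sub_zero] at hN
    exact hc (pow_eq_zero_iff two_ne_zero |>.1 hN)
  rw [isCriticalPoint_iff hr ha har]
  refine ⟨(1 - r ^ 2) / (a + z), ?_, by field_simp; ring⟩
  field_simp
  linear_combination (a + z) * hD + (1 - (r : ℂ) ^ 2) * hN

theorem HasBranchAlong.exists_lift {r a : ℝ} (hr : 0 < r) (ha : 0 < a)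
    (har : a + r < 1 / 2) {Z : ℂ → ℂ} (hZ : MeromorphicAt Z 0)
    (hcrit : ∀ᶠ τ in 𝓝[≠] (0 : ℂ), ¬ IsCriticalPoint (curveF r a) (Z τ))
    (h : HasBranchAlong (curveF r a) Z) :
    ∃ ω : ℂ → ℂ, MeromorphicAt ω 0 ∧
      (∀ᶠ τ in 𝓝[≠] (0 : ℂ), ω τ ≠ 0 ∧ ratMap r a (ω τ) = Z τ) ∧
      ∃ U ∈ 𝓝[≠] (0 : ℂ), Set.InjOn ω U := by
  obtain ⟨φ, hφ, hF, U, hU, hinj⟩ := h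
  -- The solution w of `param_linear`; it is visibly meromorphic, and its denominator can vanish
  -- only over a critical point.
  let ω : ℂ → ℂ := fun τ => (r * ((1 - r ^ 2) ^ 2 - (a + Z τ) * (a + φ τ))) /
    ((1 - r ^ 2) * (2 * a * r ^ 2 - a + φ τ) + (a + Z τ) * (a - Z τ - 2 * a * r ^ 2))
  have key : ∀ᶠ τ in 𝓝[≠] (0 : ℂ),
      ω τ ≠ 0 ∧ ratMap r a (ω τ) = Z τ ∧ ratMap r a (ω τ)⁻¹ = φ τ := by
    filter_upwards [hF, hcrit] with τ h1 h2
    obtain ⟨w, hw, hz, hξ⟩ := (curveF_eq_zero_iff (rParam_cast_ne_zero hr) _ _ _).1 h1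
    have hl := param_linear hw hz hξ
    have hD : (1 - (r : ℂ) ^ 2) * (2 * a * r ^ 2 - a + φ τ)
        + (a + Z τ) * (a - Z τ - 2 * a * r ^ 2) ≠ 0 := by
      intro hD
      rw [hD, zero_mul] at hl
      exact h2 (isCriticalPoint_of_param_linear_degenerate hr ha har hD
        ((mul_eq_zero.1 hl.symm).resolve_left (rParam_cast_ne_zero hr)))
    have : ω τ = w := by
      simp only [ω]
      rw [← hl, mul_div_cancel_left₀ _ hD]
    rw [this]
    exact ⟨hw, hz, hξ⟩
  refine ⟨ω, by fun_prop, key.mono fun τ h => ⟨h.1, h.2.1⟩, _, Filter.inter_mem hU key, ?_⟩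
  rintro x ⟨hx, -, hx1, hx2⟩ y ⟨hy, -, hy1, hy2⟩ hxy
  exact hinj hx hy (Prod.ext (by simp only; rw [← hx2, ← hy2, hxy])
    (by simp only; rw [← hx1, ← hy1, hxy]))

/-- Take ξ = h(1/ψ). Since |ψ| < 1, its inverse lies where h is injective, so ξ alone already
separates parameters. -/
theorem hasBranchAlong_of_lift {r a : ℝ} (hr : 0 < r) (ha : 0 < a)
    (har : a + r < 1 / 2) {Z ψ : ℂ → ℂ} (hψ : AnalyticAt ℂ ψ 0) (h0 : ‖ψ 0‖ < 1)
    (hZ : ∀ᶠ τ in 𝓝[≠] (0 : ℂ), ψ τ ≠ 0 ∧ ratMap r a (ψ τ) = Z τ)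
    (hinj : ∃ U ∈ 𝓝 (0 : ℂ), Set.InjOn ψ U) : HasBranchAlong (curveF r a) Z := by
  obtain ⟨U, hU, hinj⟩ := hinj
  have hmer : MeromorphicAt ψ 0 := hψ.meromorphicAt
  refine ⟨fun τ => ratMap r a (ψ τ)⁻¹, ?_, ?_, _,
    Filter.inter_mem (nhdsWithin_le_nhds hU) (Filter.inter_mem hZ
      (nhdsWithin_le_nhds (hψ.continuousAt.norm.eventually_lt continuousAt_const h0))), ?_⟩
  · unfold ratMap
    fun_prop
  · filter_upwards [hZ] with τ hτ
    exact (curveF_eq_zero_iff (rParam_cast_ne_zero hr) _ _ _).2 ⟨ψ τ, hτ.1, hτ.2, rfl⟩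
  · rintro x ⟨hx, ⟨hx0, -⟩, hx1⟩ y ⟨hy, ⟨hy0, -⟩, hy1⟩ hxy
    have hx1 : ‖ψ x‖ < 1 := hx1
    have hy1 : ‖ψ y‖ < 1 := hy1
    have e : ratMap r a (ψ x)⁻¹ = ratMap r a (ψ y)⁻¹ := congrArg Prod.fst hxy
    refine hinj hx hy (inv_injective (ratMap_inj_of_one_le_norm hr ha har ?_ ?_ e))
    · rw [norm_inv]; exact (one_le_inv₀ (norm_pos_iff.2 hx0)).2 hx1.le
    · rw [norm_inv]; exact (one_le_inv₀ (norm_pos_iff.2 hy0)).2 hy1.le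

theorem eventually_not_isCriticalPoint {r a : ℝ} (hr : 0 < r) (ha : 0 < a)
    (har : a + r < 1 / 2) {Z : ℂ → ℂ} (hZ : ∀ c, ∀ᶠ τ in 𝓝[≠] (0 : ℂ), Z τ ≠ c) :
    ∀ᶠ τ in 𝓝[≠] (0 : ℂ), ¬ IsCriticalPoint (curveF r a) (Z τ) := by
  simp_rw [isCriticalPoint_iff_eq hr ha har, not_or]
  exact (hZ _).and ((hZ _).and (hZ _))

theorem eventually_add_pow_ne (b : ℂ) {k : ℕ} (hk : k ≠ 0) (c : ℂ) :
    ∀ᶠ τ in 𝓝[≠] (0 : ℂ), b + τ ^ k ≠ c := by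
  by_cases h : b = c
  · filter_upwards [self_mem_nhdsWithin] with τ hτ
    have hτ : τ ≠ 0 := hτ
    simp [h, hτ]
  · have : ContinuousAt (fun τ : ℂ => b + τ ^ k) 0 := by fun_prop
    exact (this.eventually_ne (by simpa [hk] using h)).filter_mono nhdsWithin_le_nhds

theorem eventually_inv_pow_ne {k : ℕ} (hk : k ≠ 0) (c : ℂ) :
    ∀ᶠ τ in 𝓝[≠] (0 : ℂ), (τ ^ k)⁻¹ ≠ c := by
  refine (eventually_add_pow_ne 0 hk c⁻¹).mono fun τ h h' => h ?_
  rw [← h', inv_inv, zero_add]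

theorem ratMap_equation {r a w z : ℂ} (hw : w ≠ 0) (h : ratMap r a w = z) :
    w ^ 2 * z = r * w ^ 3 + a * w ^ 2 + 2 * a * r * w + r ^ 2 := by
  rw [← h]
  unfold ratMap
  field_simp

theorem ratMap_inv_equation {r a w z : ℂ} (hw : w ≠ 0) (h : ratMap r a w = z) :
    w⁻¹ * z = r + a * w⁻¹ + 2 * a * r * w⁻¹ ^ 2 + r ^ 2 * w⁻¹ ^ 3 := by
  rw [← h]
  unfold ratMap
  field_simp

/-- A lift `ω` is holomorphic, or it has a simple pole. -/
theorem lift_cases {ω : ℂ → ℂ} (hω : MeromorphicAt ω 0) {U : Set ℂ} (hU : U ∈ 𝓝[≠] (0 : ℂ))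
    (hinj : Set.InjOn ω U) :
    (∃ f q : ℂ → ℂ, AnalyticAt ℂ f 0 ∧ ω =ᶠ[𝓝[≠] 0] f ∧ AnalyticAt ℂ q 0 ∧ q 0 ≠ 0 ∧
      ∀ᶠ τ in 𝓝 0, f τ - f 0 = τ * q τ) ∨
    (∃ f q : ℂ → ℂ, AnalyticAt ℂ f 0 ∧ f 0 = 0 ∧ (fun τ => (ω τ)⁻¹) =ᶠ[𝓝[≠] 0] f ∧
      AnalyticAt ℂ q 0 ∧ q 0 ≠ 0 ∧ ∀ᶠ τ in 𝓝 0, f τ = τ * q τ) := by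
  have key : ∀ {ω : ℂ → ℂ}, MeromorphicAt ω 0 → Set.InjOn ω U → 0 ≤ meromorphicOrderAt ω 0 →
      ∃ f q : ℂ → ℂ, AnalyticAt ℂ f 0 ∧ ω =ᶠ[𝓝[≠] 0] f ∧ AnalyticAt ℂ q 0 ∧ q 0 ≠ 0 ∧
      ∀ᶠ τ in 𝓝 0, f τ - f 0 = τ * q τ := by
    intro ω hω hinj ho
    obtain ⟨f, hf, hωf⟩ := hω.meromorphicOrderAt_nonneg_iff.1 ho
    obtain ⟨q, hq, hq0, hfq⟩ := exists_simple_factor_of_injOn hf (Filter.inter_mem hU hωf) (by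
      rintro x ⟨hx, hx'⟩ y ⟨hy, hy'⟩ hxy
      have hx' : ω x = f x := hx'
      have hy' : ω y = f y := hy'
      exact hinj hx hy (by rw [hx', hy', hxy]))
    exact ⟨f, q, hf, hωf, hq, hq0, hfq⟩
  rcases le_or_gt 0 (meromorphicOrderAt ω 0) with ho | ho
  · exact Or.inl (key hω hinj ho)
  · right
    have hi : MeromorphicAt (fun τ => (ω τ)⁻¹) 0 := hω.inv
    have ht : Filter.Tendsto (fun τ => (ω τ)⁻¹) (𝓝[≠] 0) (𝓝 0) :=
      Filter.tendsto_inv₀_cobounded.comp (tendsto_cobounded_of_meromorphicOrderAt_neg ho)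
    obtain ⟨f, q, hf, hωf, hq, hq0, hfq⟩ := key hi (fun x hx y hy h => hinj hx hy (inv_injective h))
      ((tendsto_nhds_iff_meromorphicOrderAt_nonneg hi).1 ⟨0, ht⟩)
    have hf0 : f 0 = 0 :=
      tendsto_nhds_unique ((hf.continuousAt.tendsto.mono_left nhdsWithin_le_nhds).congr' hωf.symm) ht
    rw [hf0] at hfq
    exact ⟨f, q, hf, hf0, hωf, hq, hq0, by simpa using hfq⟩

theorem eventuallyEq_of_punctured {f g : ℂ → ℂ} (hf : ContinuousAt f 0) (hg : ContinuousAt g 0)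
    (h : ∀ᶠ τ in 𝓝[≠] (0 : ℂ), f τ = g τ) : ∀ᶠ τ in 𝓝 (0 : ℂ), f τ = g τ :=
  (hf.eventuallyEq_nhds_iff_eventuallyEq_nhdsNE hg).1 h

/-- The poles of h are w = 0, which is double and gives k = 2, and w = ∞, which is simple and would
give k = 1. -/
theorem isBranchPointAtInfinity_iff {r a : ℝ} (hr : 0 < r) (ha : 0 < a) (har : a + r < 1 / 2)
    (k : ℕ) : IsBranchPointAtInfinity (curveF r a) k ↔ k = 2 := by
  have hr0 := rParam_cast_ne_zero hr
  constructor
  · rintro ⟨hk, h⟩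
    obtain ⟨ω, hω, hZ, U, hU, hinj⟩ := h.exists_lift hr ha har (by fun_prop)
      (eventually_not_isCriticalPoint hr ha har (eventually_inv_pow_ne (by omega)))
    rcases lift_cases hω hU hinj with ⟨f, q, hf, hωf, hq, hq0, hfq⟩ | ⟨f, q, hf, hf0, hωf, hq, hq0, hfq⟩
    · have e1 : ∀ᶠ τ in 𝓝[≠] (0 : ℂ),
          f τ ^ 2 = τ ^ k * (r * f τ ^ 3 + a * f τ ^ 2 + 2 * a * r * f τ + r ^ 2) := by
        filter_upwards [hZ, hωf, self_mem_nhdsWithin] with τ h1 h2 h3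
        have h3 : τ ≠ 0 := h3
        rw [← h2, ← ratMap_equation h1.1 h1.2]
        field_simp
      have e2 := (eventuallyEq_of_punctured (by fun_prop) (by fun_prop) e1).self_of_nhds
      have hf0 : f 0 = 0 := by simpa [show k ≠ 0 by omega] using e2
      refine (pow_exponent_unique (u := fun τ => q τ ^ 2)
        (v := fun τ => r * f τ ^ 3 + a * f τ ^ 2 + 2 * a * r * f τ + r ^ 2) (m := 2) (k := k)
        (by fun_prop) (by fun_prop) (by simpa using hq0) (by simpa [hf0] using hr0) ?_).symm
      filter_upwards [e1, hfq.filter_mono nhdsWithin_le_nhds] with τ h1 h2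
      rw [hf0, sub_zero] at h2
      rw [← h1, h2]; ring
    · exfalso
      have := pow_exponent_unique (u := q)
        (v := fun τ => r + a * f τ + 2 * a * r * f τ ^ 2 + r ^ 2 * f τ ^ 3) (m := 1) (k := k)
        (by fun_prop) (by fun_prop) hq0 (by simpa [hf0] using hr0) ?_
      · omega
      filter_upwards [hZ, hωf, hfq.filter_mono nhdsWithin_le_nhds, self_mem_nhdsWithin]
        with τ h1 h2 h3 h4
      have h4 : τ ≠ 0 := h4
      rw [pow_one, ← h3, ← h2, ← ratMap_inv_equation h1.1 h1.2]
      field_simp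
  · rintro rfl
    refine ⟨le_rfl, ?_⟩
    have hd : (r : ℂ) * 0 ^ 3 + a * 0 ^ 2 + 2 * a * r * 0 + r ^ 2 ≠ 0 := by simpa using hr0
    obtain ⟨ψ, hψ, hψ0, hψk, hinj⟩ := exists_pow_uniformizer (k := 2)
      (g := fun w => (r * w ^ 3 + a * w ^ 2 + 2 * a * r * w + r ^ 2 : ℂ)⁻¹) (w₀ := 0) two_pos
      (AnalyticAt.inv (by fun_prop) hd) (inv_ne_zero hd)
    refine hasBranchAlong_of_lift hr ha har hψ (by simp [hψ0]) ?_ hinj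
    filter_upwards [hψk.filter_mono nhdsWithin_le_nhds, self_mem_nhdsWithin] with τ h1 h2
    have h2 : τ ≠ 0 := h2
    have h3 : ψ τ ≠ 0 := by
      intro h
      rw [h, sub_zero, zero_pow two_ne_zero, zero_mul] at h1
      exact pow_ne_zero 2 h2 h1.symm
    refine ⟨h3, ?_⟩
    rw [← h1, sub_zero, mul_inv, inv_inv]
    unfold ratMap
    field_simp

/-- The order k is the multiplicity in the fibre of the limit point f(0) of the lift: the lift has a
simple zero of f - f(0), so `e3` equates that multiplicity with k. -/
theorem isBranchPoint_iff {r a : ℝ} (hr : 0 < r) (ha : 0 < a) (har : a + r < 1 / 2)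
    (k : ℕ) (b : ℂ) : IsBranchPoint (curveF r a) k b ↔
      ∃ w₁ w₃, IsFiber r a b w₁ w₁ w₃ ∧ ((k = 2 ∧ w₁ ≠ w₃) ∨ (k = 3 ∧ w₁ = w₃)) := by
  have hr0 := rParam_cast_ne_zero hr
  constructor
  · rintro ⟨hk, h⟩
    obtain ⟨ω, hω, hZ, U, hU, hinj⟩ := h.exists_lift hr ha har (by fun_prop)
      (eventually_not_isCriticalPoint hr ha har (eventually_add_pow_ne b (by omega)))
    rcases lift_cases hω hU hinj with ⟨f, q, hf, hωf, hq, hq0, hfq⟩ | ⟨f, q, hf, hf0, hωf, hq, hq0, hfq⟩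
    · have e1 : ∀ᶠ τ in 𝓝[≠] (0 : ℂ),
          f τ ^ 2 * (b + τ ^ k) = r * f τ ^ 3 + a * f τ ^ 2 + 2 * a * r * f τ + r ^ 2 := by
        filter_upwards [hZ, hωf] with τ h1 h2
        rw [← h2, ← ratMap_equation h1.1 h1.2]
      have e2 := (eventuallyEq_of_punctured (by fun_prop) (by fun_prop) e1).self_of_nhds
      simp only [zero_pow (show k ≠ 0 by omega), add_zero] at e2
      have hf0 : f 0 ≠ 0 := by
        intro h
        rw [h] at e2
        simp at e2
        exact pow_ne_zero 2 hr0 e2.symm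
      have hb : ratMap r a (f 0) = b := by
        unfold ratMap
        field_simp
        linear_combination -e2
      obtain ⟨w₂, w₃, hw⟩ : ∃ w₂ w₃, IsFiber r a b (f 0) w₂ w₃ := by
        obtain ⟨w₁, w₂, w₃, hw⟩ := exists_isFiber hr0 a b
        rcases (hw.ratMap_eq_iff hr0 hf0).1 hb with h | h | h
        · exact ⟨_, _, h ▸ hw⟩
        · exact ⟨_, _, h ▸ hw.rotate⟩
        · exact ⟨_, _, h ▸ hw.rotate.rotate⟩
      have e3 : ∀ᶠ τ in 𝓝[≠] (0 : ℂ),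
          τ * (r * q τ) * ((f τ - w₂) * (f τ - w₃)) = τ ^ k * f τ ^ 2 := by
        filter_upwards [hZ, hωf, hfq.filter_mono nhdsWithin_le_nhds] with τ h1 h2 h3
        have h4 := hw.ratMap_sub h1.1
        rw [h1.2, add_sub_cancel_left, h2, h3] at h4
        have h5 : f τ ≠ 0 := h2 ▸ h1.1
        rw [h4]
        field_simp
      have hsq : f 0 ^ 2 ≠ 0 := pow_ne_zero 2 hf0
      have two : ∀ {w₃}, IsFiber r a b (f 0) (f 0) w₃ → f 0 ≠ w₃ →
          (∀ᶠ τ in 𝓝[≠] (0 : ℂ),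
            τ * (r * q τ) * ((f τ - f 0) * (f τ - w₃)) = τ ^ k * f τ ^ 2) → k = 2 := by
        intro w₃ hw hne e3
        refine (pow_exponent_unique (u := fun τ => r * q τ ^ 2 * (f τ - w₃))
          (v := fun τ => f τ ^ 2) (m := 2) (by fun_prop) (by fun_prop)
          (mul_ne_zero (mul_ne_zero hr0 (pow_ne_zero 2 hq0)) (sub_ne_zero.2 hne)) hsq ?_).symm
        filter_upwards [e3, hfq.filter_mono nhdsWithin_le_nhds] with τ h1 h2
        rw [← h1, h2]; ring
      by_cases h2 : f 0 = w₂
      · rw [← h2] at hw e3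
        by_cases h3 : f 0 = w₃
        · refine ⟨_, _, hw, Or.inr ⟨?_, h3⟩⟩
          rw [← h3] at e3
          refine (pow_exponent_unique (u := fun τ => r * q τ ^ 3)
            (v := fun τ => f τ ^ 2) (m := 3) (by fun_prop) (by fun_prop)
            (mul_ne_zero hr0 (pow_ne_zero 3 hq0)) hsq ?_).symm
          filter_upwards [e3, hfq.filter_mono nhdsWithin_le_nhds] with τ h1 h2
          rw [← h1, h2]; ring
        · exact ⟨_, _, hw, Or.inl ⟨two hw h3 e3, h3⟩⟩
      · by_cases h3 : f 0 = w₃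
        · rw [← h3] at hw e3
          have hw' := hw.rotate.rotate
          exact ⟨_, _, hw', Or.inl ⟨two hw' h2 (e3.mono fun τ h => by rw [← h]; ring), h2⟩⟩
        · exfalso
          have := pow_exponent_unique (u := fun τ => r * q τ * ((f τ - w₂) * (f τ - w₃)))
            (v := fun τ => f τ ^ 2) (m := 1) (k := k) (by fun_prop) (by fun_prop)
            (mul_ne_zero (mul_ne_zero hr0 hq0) (mul_ne_zero (sub_ne_zero.2 h2) (sub_ne_zero.2 h3)))
            hsq ?_
          · omega
          filter_upwards [e3] with τ h1
          rw [← h1]; ring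
    · exfalso
      have e1 : ∀ᶠ τ in 𝓝[≠] (0 : ℂ),
          f τ * (b + τ ^ k) = r + a * f τ + 2 * a * r * f τ ^ 2 + r ^ 2 * f τ ^ 3 := by
        filter_upwards [hZ, hωf] with τ h1 h2
        rw [← h2, ← ratMap_inv_equation h1.1 h1.2]
      have e2 := (eventuallyEq_of_punctured (by fun_prop) (by fun_prop) e1).self_of_nhds
      rw [hf0] at e2
      simp at e2
      exact hr0 e2.symm
  · rintro ⟨w₁, w₃, hw, h⟩
    have hw0 := hw.ne_zero hr0
    have hn := norm_lt_one_of_critical hr ha har hw.critical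
    have main : ∀ g : ℂ → ℂ, AnalyticAt ℂ g w₁ → g w₁ ≠ 0 → 0 < k →
        (∀ w, w ≠ 0 → (w - w₁) ^ k * g w = ratMap r a w - b) →
        HasBranchAlong (curveF r a) (fun τ => b + τ ^ k) := by
      intro g hg hg0 hk hgw
      obtain ⟨ψ, hψ, hψ0, hψk, hinj⟩ := exists_pow_uniformizer hk hg hg0
      refine hasBranchAlong_of_lift hr ha har hψ (by rwa [hψ0]) ?_ hinj
      filter_upwards [hψk.filter_mono nhdsWithin_le_nhds,
        (hψ.continuousAt.eventually_ne (hψ0 ▸ hw0)).filter_mono nhdsWithin_le_nhds] with τ h1 h2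
      refine ⟨h2, ?_⟩
      rw [← h1, hgw _ h2]; ring
    have hsq : w₁ ^ 2 ≠ 0 := pow_ne_zero 2 hw0
    rcases h with ⟨rfl, h⟩ | ⟨rfl, rfl⟩
    · refine ⟨le_rfl, main (fun w => r * (w - w₃) / w ^ 2) (by fun_prop (disch := assumption))
        (div_ne_zero (mul_ne_zero hr0 (sub_ne_zero.2 h)) hsq) two_pos fun w hw' => ?_⟩
      rw [hw.ratMap_sub hw']; ring
    · refine ⟨by norm_num, main (fun w => r / w ^ 2) (by fun_prop (disch := assumption))
        (div_ne_zero hr0 hsq) three_pos fun w hw' => ?_⟩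
      rw [hw.ratMap_sub hw']; ring

/-! ### Critical values of h: reality, order and position -/

/-- The value of the parametrization at a critical point `w`, that is, where
`w ^ 3 = 2 a w + 2 r`. -/
def critValue {K : Type*} [Field K] (r a w : K) : K := a + r * (2 * w - r / w ^ 2)

theorem ofReal_critValue (r a w : ℝ) : ((critValue r a w : ℝ) : ℂ) = critValue (r : ℂ) a w := by
  unfold critValue; push_cast; ring

theorem conj_critValue (r a : ℝ) (w : ℂ) :
    (starRingEnd ℂ) (critValue (r : ℂ) a w) = critValue (r : ℂ) a ((starRingEnd ℂ) w) := by
  simp only [critValue, map_add, map_mul, map_sub, map_div₀, map_pow, Complex.conj_ofReal,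
    map_ofNat]

/-- The third root of the cubic is -(w + v), so a and r are symmetric functions of w and v. The cube
gives distinctness, the real ordering and the sign of the imaginary part at once. -/
theorem critValue_sub {K : Type*} [Field K] [CharZero K] {r a w v : K} (hw : w ≠ 0) (hv : v ≠ 0)
    (hwv : w ≠ v) (h1 : w ^ 3 = 2 * a * w + 2 * r) (h2 : v ^ 3 = 2 * a * v + 2 * r) :
    critValue r a w - critValue r a v = -(r / (2 * (w * v))) * (w - v) ^ 3 := by
  have e1 : w ^ 2 + w * v + v ^ 2 = 2 * a := by
    apply mul_left_cancel₀ (sub_ne_zero.2 hwv)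
    linear_combination h1 - h2
  have e2 : r = -(w * v * (w + v)) / 2 := by linear_combination (-1 / 2) * h1 + (w / 2) * e1
  unfold critValue
  rw [e2]
  field_simp
  ring

theorem critical_ne_zero {K : Type*} [Field K] [CharZero K] {r a w : K} (hr : r ≠ 0)
    (h : w ^ 3 = 2 * a * w + 2 * r) : w ≠ 0 := by
  rintro rfl
  simp at h
  exact hr h

theorem critValue_ne {K : Type*} [Field K] [CharZero K] {r a w v : K} (hr : r ≠ 0)
    (hwv : w ≠ v) (h1 : w ^ 3 = 2 * a * w + 2 * r) (h2 : v ^ 3 = 2 * a * v + 2 * r) :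
    critValue r a w ≠ critValue r a v := by
  have hw := critical_ne_zero hr h1
  have hv := critical_ne_zero hr h2
  rw [← sub_ne_zero, critValue_sub hw hv hwv h1 h2]
  have := sub_ne_zero.2 hwv
  simp [hr, hw, hv, this]

theorem isFiber_critValue {r a w : ℂ} (hw : w ≠ 0) (h : w ^ 3 = 2 * a * w + 2 * r) :
    IsFiber r a (critValue r a w) w w (-r / w ^ 2) := by
  refine ⟨by unfold critValue; ring, ?_, by field_simp⟩
  field_simp
  linear_combination h

/-- The fibre is w, w, -r/w²; the hypothesis on |w|² places the third point in the disc. -/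
theorem critValue_mem_Omega {r a : ℝ} (hr : 0 < r) (ha : 0 < a) (har : a + r < 1 / 2) {w : ℂ}
    (h : w ^ 3 = 2 * a * w + 2 * r) (hw : r < ‖w‖ ^ 2) :
    critValue (r : ℂ) a w ∈ Omega (paramT0 r a) (paramT1 r a) := by
  have hn := norm_lt_one_of_critical hr ha har h
  refine (isFiber_critValue (critical_ne_zero (rParam_cast_ne_zero hr) h) h).mem_Omega hr ha har
    hn hn ?_
  rw [norm_div, norm_neg, norm_pow, Complex.norm_real, Real.norm_of_nonneg hr.le,
    div_lt_one (by linarith)]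
  exact hw

theorem isBranchPoint_iff_critValue {r a : ℝ} (hr : 0 < r) (ha : 0 < a) (har : a + r < 1 / 2)
    (k : ℕ) (b : ℂ) : IsBranchPoint (curveF r a) k b ↔
      ∃ w : ℂ, w ^ 3 = 2 * a * w + 2 * r ∧ b = critValue (r : ℂ) a w ∧
        ((k = 2 ∧ w ^ 3 ≠ -r) ∨ (k = 3 ∧ w ^ 3 = -r)) := by
  have hr0 := rParam_cast_ne_zero hr
  rw [isBranchPoint_iff hr ha har]
  have key : ∀ w : ℂ, w ≠ 0 → (w = -r / w ^ 2 ↔ w ^ 3 = -r) := fun w hw => by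
    rw [eq_div_iff (pow_ne_zero 2 hw), ← pow_succ']
  constructor
  · rintro ⟨w, w₃, hw, h⟩
    have hw0 := hw.ne_zero hr0
    obtain rfl : w₃ = -r / w ^ 2 := by
      rw [eq_div_iff (pow_ne_zero 2 hw0), ← hw.2.2]; ring
    rw [key w hw0, ne_eq, key w hw0] at h
    exact ⟨w, hw.critical, by rw [← hw.1]; unfold critValue; ring, h⟩
  · rintro ⟨w, hc, rfl, h⟩
    have hw0 := critical_ne_zero hr0 hc
    refine ⟨w, _, isFiber_critValue hw0 hc, ?_⟩
    rwa [ne_eq, key w hw0]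

theorem discr_eq_of_cube_eq {r a : ℝ} {w : ℂ} (hr : 0 < r)
    (h : w ^ 3 = 2 * a * w + 2 * r) (hw : w ^ 3 = -r) : 8 * a ^ 3 = 27 * r ^ 2 := by
  have h1 : 2 * a * w = -3 * r := by linear_combination hw - h
  have h2 : (r : ℂ) * (8 * a ^ 3) = r * (27 * r ^ 2) := by
    have : (2 * a * w) ^ 3 = (-3 * r : ℂ) ^ 3 := by rw [h1]
    linear_combination (8 * a ^ 3 : ℂ) * hw - this
  have := mul_left_cancel₀ (rParam_cast_ne_zero hr) h2
  exact_mod_cast this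

theorem isBranchPoint_iff_of_discr_ne {r a : ℝ} (hr : 0 < r) (ha : 0 < a) (har : a + r < 1 / 2)
    (hd : 8 * a ^ 3 ≠ 27 * r ^ 2) {w₀ w₁ w₂ : ℂ}
    (hroots : ∀ w : ℂ, w ^ 3 = 2 * a * w + 2 * r ↔ w = w₀ ∨ w = w₁ ∨ w = w₂) (k : ℕ) (b : ℂ) :
    IsBranchPoint (curveF r a) k b ↔ k = 2 ∧ (b = critValue (r : ℂ) a w₀ ∨
      b = critValue (r : ℂ) a w₁ ∨ b = critValue (r : ℂ) a w₂) := by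
  rw [isBranchPoint_iff_critValue hr ha har]
  constructor
  · rintro ⟨w, hc, rfl, ⟨rfl, -⟩ | ⟨-, h⟩⟩
    · refine ⟨rfl, ?_⟩
      rcases (hroots w).1 hc with rfl | rfl | rfl <;> simp
    · exact absurd (discr_eq_of_cube_eq hr hc h) hd
  · rintro ⟨rfl, h⟩
    have : ∀ w : ℂ, w ^ 3 = 2 * a * w + 2 * r → ∃ v : ℂ, v ^ 3 = 2 * a * v + 2 * r ∧
        critValue (r : ℂ) a w = critValue (r : ℂ) a v ∧
        ((2 = 2 ∧ v ^ 3 ≠ -r) ∨ (2 = 3 ∧ v ^ 3 = -r)) := fun w hc =>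
      ⟨w, hc, rfl, Or.inl ⟨rfl, fun h => hd (discr_eq_of_cube_eq hr hc h)⟩⟩
    rcases h with rfl | rfl | rfl
    · exact this _ ((hroots _).2 (by simp))
    · exact this _ ((hroots _).2 (by simp))
    · exact this _ ((hroots _).2 (by simp))

theorem exists_pos_critical {r a : ℝ} (hr : 0 < r) (har : a + r < 1 / 2) :
    ∃ x, 0 < x ∧ x < 1 ∧ x ^ 3 = 2 * a * x + 2 * r := by
  have hc : ContinuousOn (fun x : ℝ => x ^ 3 - 2 * a * x - 2 * r) (Set.Icc 0 1) := by fun_prop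
  obtain ⟨x, ⟨h0, h1⟩, hx⟩ := intermediate_value_Ioo zero_le_one hc
    (show (0 : ℝ) ∈ Set.Ioo _ _ from ⟨by norm_num; exact hr, by norm_num; linarith⟩)
  exact ⟨x, h0, h1, by simp only at hx; linarith⟩

theorem critical_iff {r a x : ℝ} {w₁ w₂ : ℂ} (hx : x ^ 3 = 2 * a * x + 2 * r)
    (hs : w₁ + w₂ = -x) (hp : w₁ * w₂ = x ^ 2 - 2 * a) (w : ℂ) :
    w ^ 3 = 2 * a * w + 2 * r ↔ w = x ∨ w = w₁ ∨ w = w₂ := by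
  have hx' : (x : ℂ) ^ 3 = 2 * a * x + 2 * r := by exact_mod_cast hx
  have : w ^ 3 - (2 * a * w + 2 * r) = (w - x) * ((w - w₁) * (w - w₂)) := by
    linear_combination (w - x) * w * hs - (w - x) * hp + hx'
  rw [← sub_eq_zero, this, mul_eq_zero, mul_eq_zero, sub_eq_zero, sub_eq_zero, sub_eq_zero]

theorem branchPoints_of_param {r a : ℝ} (hr : 0 < r) (ha : 0 < a) (har : a + r < 1 / 2) :
    ∃ (z0 : ℝ) (z1 z2 : ℂ),
      0 < z0 ∧ z0 < 1 - a - r ^ 2 ∧ (z0 : ℂ) ∈ Omega (paramT0 r a) (paramT1 r a) ∧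
      (8 * a ^ 3 ≠ 27 * r ^ 2 →
        (z0 : ℂ) ≠ z1 ∧ (z0 : ℂ) ≠ z2 ∧ z1 ≠ z2 ∧
        ∀ (k : ℕ) (b : ℂ), IsBranchPoint (curveF r a) k b ↔
          k = 2 ∧ (b = z0 ∨ b = z1 ∨ b = z2)) ∧
      (8 * a ^ 3 < 27 * r ^ 2 →
        z1.im < 0 ∧ (starRingEnd ℂ) z2 = z1 ∧
        z1 ∈ Omega (paramT0 r a) (paramT1 r a) ∧ z2 ∈ Omega (paramT0 r a) (paramT1 r a)) ∧
      (27 * r ^ 2 < 8 * a ^ 3 →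
        z1.im = 0 ∧ z2.im = 0 ∧ z2.re < z1.re ∧ z1.re < z0 ∧
        z1 ∈ Omega (paramT0 r a) (paramT1 r a)) ∧
      (8 * a ^ 3 = 27 * r ^ 2 →
        z1 = z2 ∧ z1.im = 0 ∧ z1.re < z0 ∧ z1 ∈ Omega (paramT0 r a) (paramT1 r a) ∧
        ∀ (k : ℕ) (b : ℂ), IsBranchPoint (curveF r a) k b ↔
          (k = 2 ∧ b = z0) ∨ (k = 3 ∧ b = z1)) := by
  obtain ⟨x, hx0, hx1, hx⟩ := exists_pos_critical hr har
  have hr0 := rParam_cast_ne_zero hr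
  have hx' : (x : ℂ) ^ 3 = 2 * a * x + 2 * r := by exact_mod_cast hx
  -- the product of the two other critical points
  have hM : (x ^ 2 - 2 * a) * x = 2 * r := by linear_combination hx
  have hMr : r < x ^ 2 - 2 * a := by
    by_contra hc
    push Not at hc
    nlinarith
  have hM0 : 0 < x ^ 2 - 2 * a := by linarith
  -- Discriminant of the cubic: that of the remaining quadratic X² + xX + (x² - 2a), times the
  -- square of that quadratic's value at x.
  have hdisc : (8 * a - 3 * x ^ 2) * (3 * x ^ 2 - 2 * a) ^ 2 = 4 * (8 * a ^ 3 - 27 * r ^ 2) := by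
    have : r = (x ^ 2 - 2 * a) * x / 2 := by linarith
    rw [this]; ring
  have hsq : 0 < (3 * x ^ 2 - 2 * a) ^ 2 := by
    have : 0 < 3 * x ^ 2 - 2 * a := by nlinarith
    positivity
  have hz0 : 0 < critValue r a x := by
    unfold critValue
    have : r / x ^ 2 < 2 * x := by
      rw [div_lt_iff₀ (by positivity)]
      nlinarith [mul_pos ha hx0]
    have := mul_pos hr (sub_pos.2 this)
    linarith
  have hc0 : critValue r a x < 1 - a - r ^ 2 := by
    unfold critValue
    have h1 : r ≤ r / x ^ 2 := by
      rw [le_div_iff₀ (by positivity)]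
      exact mul_le_of_le_one_right hr.le (pow_le_one₀ hx0.le hx1.le)
    nlinarith
  have hzΩ : ((critValue r a x : ℝ) : ℂ) ∈ Omega (paramT0 r a) (paramT1 r a) := by
    rw [ofReal_critValue]
    refine critValue_mem_Omega hr ha har hx' ?_
    rw [Complex.norm_real, Real.norm_of_nonneg hx0.le]
    linarith
  have distinct : ∀ {w₁ w₂ : ℂ}, w₁ + w₂ = -x → w₁ * w₂ = x ^ 2 - 2 * a → (x : ℂ) ≠ w₁ →
      (x : ℂ) ≠ w₂ → w₁ ≠ w₂ → 8 * a ^ 3 ≠ 27 * r ^ 2 →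
      ((critValue r a x : ℝ) : ℂ) ≠ critValue (r : ℂ) a w₁ ∧
      ((critValue r a x : ℝ) : ℂ) ≠ critValue (r : ℂ) a w₂ ∧
      critValue (r : ℂ) a w₁ ≠ critValue (r : ℂ) a w₂ ∧
      ∀ (k : ℕ) (b : ℂ), IsBranchPoint (curveF r a) k b ↔
        k = 2 ∧ (b = (critValue r a x : ℝ) ∨ b = critValue (r : ℂ) a w₁ ∨
          b = critValue (r : ℂ) a w₂) := by
    intro w₁ w₂ hs hp h1 h2 h3 hd
    have hroots := critical_iff hx hs hp
    have c1 := (hroots w₁).2 (by simp)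
    have c2 := (hroots w₂).2 (by simp)
    rw [ofReal_critValue]
    exact ⟨critValue_ne hr0 h1 hx' c1, critValue_ne hr0 h2 hx' c2, critValue_ne hr0 h3 c1 c2,
      isBranchPoint_iff_of_discr_ne hr ha har hd hroots⟩
  have below : ∀ v : ℝ, v < 0 → v ^ 3 = 2 * a * v + 2 * r → critValue r a v < critValue r a x := by
    intro v hv hc
    rw [← sub_pos, critValue_sub hx0.ne' hv.ne (by linarith) hx hc]
    have h1 : 0 < -(x * v) := by nlinarith
    have h2 : 0 < x - v := by linarith
    have : -(r / (2 * (x * v))) = r / (2 * -(x * v)) := by rw [mul_neg, div_neg]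
    rw [this]
    positivity
  rcases lt_trichotomy (8 * a ^ 3) (27 * r ^ 2) with hd | hd | hd
  · -- two complex conjugate critical points
    have hneg : 0 < 3 * x ^ 2 - 8 * a := by
      by_contra hc
      push Not at hc
      nlinarith
    set y := Real.sqrt (3 * x ^ 2 - 8 * a) / 2 with hy
    have hy0 : 0 < y := by positivity
    have hy2 : y ^ 2 = (3 * x ^ 2 - 8 * a) / 4 := by
      rw [hy, div_pow, Real.sq_sqrt hneg.le]; norm_num
    let w : ℂ := ⟨-x / 2, -y⟩
    have hs : w + (starRingEnd ℂ) w = -x := by apply Complex.ext <;> simp [w]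
    have hp : w * (starRingEnd ℂ) w = x ^ 2 - 2 * a := by
      rw [Complex.mul_conj]
      have : Complex.normSq w = x ^ 2 - 2 * a := by
        simp only [w, Complex.normSq_apply]; linear_combination hy2
      rw [this]; push_cast; ring
    have hnorm : ‖w‖ ^ 2 = x ^ 2 - 2 * a := by
      rw [← Complex.normSq_eq_norm_sq]
      simp only [w, Complex.normSq_apply]; linear_combination hy2
    have hne : w ≠ (starRingEnd ℂ) w := by
      intro h
      have := congrArg Complex.im h
      simp [w] at this
      linarith
    have hxw : ∀ v : ℂ, v.im ≠ 0 → (x : ℂ) ≠ v := by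
      rintro v hv rfl
      exact hv (Complex.ofReal_im x)
    have hroots := critical_iff hx hs hp
    have c1 := (hroots w).2 (by simp)
    have c2 := (hroots ((starRingEnd ℂ) w)).2 (by simp)
    refine ⟨critValue r a x, critValue (r : ℂ) a w, critValue (r : ℂ) a ((starRingEnd ℂ) w),
      hz0, hc0, hzΩ, distinct hs hp (hxw _ (by simpa [w] using hy0.ne'))
        (hxw _ (by simpa [w] using hy0.ne')) hne, fun _ => ⟨?_, ?_, ?_, ?_⟩,
      fun h => absurd h hd.not_gt, fun h => absurd h hd.ne⟩
    · have e := critValue_sub (critical_ne_zero hr0 c1) (critical_ne_zero hr0 c2) hne c1 c2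
      rw [← conj_critValue, Complex.sub_conj, hp] at e
      have e' : -((r : ℂ) / (2 * (x ^ 2 - 2 * a))) * (w - (starRingEnd ℂ) w) ^ 3 =
          ((-(4 * r * y ^ 3 / (x ^ 2 - 2 * a)) : ℝ) : ℂ) * Complex.I := by
        have hM' : (x : ℂ) ^ 2 - 2 * a ≠ 0 := by exact_mod_cast hM0.ne'
        rw [Complex.sub_conj]
        simp only [w]
        push_cast
        field_simp
        ring_nf
        rw [Complex.I_sq]
        ring
      rw [e'] at e
      have e2 := mul_right_cancel₀ Complex.I_ne_zero e
      have e3 : 2 * (critValue (r : ℂ) a w).im = -(4 * r * y ^ 3 / (x ^ 2 - 2 * a)) := by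
        exact_mod_cast e2
      have : 0 < 4 * r * y ^ 3 / (x ^ 2 - 2 * a) := by positivity
      linarith
    · rw [conj_critValue, Complex.conj_conj]
    · exact critValue_mem_Omega hr ha har c1 (by rw [hnorm]; exact hMr)
    · exact critValue_mem_Omega hr ha har c2 (by rw [Complex.norm_conj, hnorm]; exact hMr)
  · -- a double critical point
    have h83 : 8 * a = 3 * x ^ 2 := by
      have : (8 * a - 3 * x ^ 2) * (3 * x ^ 2 - 2 * a) ^ 2 = 0 := by rw [hdisc, hd]; ring
      linarith [(mul_eq_zero.1 this).resolve_right hsq.ne']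
    have hrx : r = x ^ 3 / 8 := by nlinarith
    have hc : (-x / 2) ^ 3 = 2 * a * (-x / 2) + 2 * r := by rw [hrx]; linear_combination (x / 8) * h83
    have hcc : ((-x / 2 : ℝ) : ℂ) ^ 3 = 2 * a * ((-x / 2 : ℝ) : ℂ) + 2 * r := by exact_mod_cast hc
    have hs : ((-x / 2 : ℝ) : ℂ) + ((-x / 2 : ℝ) : ℂ) = -x := by push_cast; ring
    have hp : ((-x / 2 : ℝ) : ℂ) * ((-x / 2 : ℝ) : ℂ) = x ^ 2 - 2 * a := by
      have : (-x / 2) * (-x / 2) = x ^ 2 - 2 * a := by linear_combination (1 / 4) * h83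
      exact_mod_cast this
    have hroots := critical_iff hx hs hp
    refine ⟨critValue r a x, (critValue r a (-x / 2) : ℝ), (critValue r a (-x / 2) : ℝ), hz0, hc0,
      hzΩ, fun h => absurd hd h, fun h => absurd hd h.ne, fun h => absurd hd h.ne',
      fun _ => ⟨rfl, Complex.ofReal_im _, ?_, ?_, fun k b => ?_⟩⟩
    · rw [Complex.ofReal_re]
      exact below _ (by linarith) hc
    · rw [ofReal_critValue]
      refine critValue_mem_Omega hr ha har hcc ?_
      rw [Complex.norm_real, Real.norm_eq_abs, sq_abs]
      linarith
    · rw [isBranchPoint_iff_critValue hr ha har, ofReal_critValue, ofReal_critValue]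
      have n1 : (x : ℂ) ^ 3 ≠ -r := by
        have : x ^ 3 ≠ -r := by
          have := pow_pos hx0 3
          linarith
        exact_mod_cast this
      have n2 : ((-x / 2 : ℝ) : ℂ) ^ 3 = -r := by
        have : (-x / 2) ^ 3 = -r := by rw [hrx]; ring
        exact_mod_cast this
      constructor
      · rintro ⟨w, hw, rfl, h⟩
        have hw' : w = x ∨ w = ((-x / 2 : ℝ) : ℂ) := by simpa using (hroots w).1 hw
        rcases hw' with rfl | rfl
        · rcases h with ⟨rfl, -⟩ | ⟨-, h⟩
          · exact Or.inl ⟨rfl, rfl⟩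
          · exact absurd h n1
        · rcases h with ⟨-, h⟩ | ⟨rfl, -⟩
          · exact absurd n2 h
          · exact Or.inr ⟨rfl, rfl⟩
      · rintro (⟨rfl, rfl⟩ | ⟨rfl, rfl⟩)
        · exact ⟨x, hx', rfl, Or.inl ⟨rfl, n1⟩⟩
        · exact ⟨_, hcc, rfl, Or.inr ⟨rfl, n2⟩⟩
  · -- three real critical points
    have hpos : 0 < 8 * a - 3 * x ^ 2 := by
      by_contra hc
      push Not at hc
      nlinarith
    set δ := Real.sqrt (8 * a - 3 * x ^ 2) with hδ
    have hδ0 : 0 < δ := by positivity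
    have hδ2 : δ ^ 2 = 8 * a - 3 * x ^ 2 := Real.sq_sqrt hpos.le
    have hδx : δ < x := by nlinarith
    set u := (-x - δ) / 2 with hu
    set v := (-x + δ) / 2 with hv
    have hsR : u + v = -x := by rw [hu, hv]; ring
    have hpR : u * v = x ^ 2 - 2 * a := by rw [hu, hv]; linear_combination (-1 / 4) * hδ2
    have hs : (u : ℂ) + v = -x := by exact_mod_cast hsR
    have hp : (u : ℂ) * v = x ^ 2 - 2 * a := by exact_mod_cast hpR
    have hroots := critical_iff hx hs hp
    have c1 := (hroots u).2 (by simp)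
    have c2 := (hroots v).2 (by simp)
    have r1 : u ^ 3 = 2 * a * u + 2 * r := by exact_mod_cast c1
    have r2 : v ^ 3 = 2 * a * v + 2 * r := by exact_mod_cast c2
    have hu0 : u < 0 := by linarith
    have hv0 : v < 0 := by linarith
    have huv : u < v := by linarith
    have hd' := distinct hs hp (by exact_mod_cast (by linarith : u < x).ne')
      (by exact_mod_cast (by linarith : v < x).ne') (by exact_mod_cast huv.ne)
    rw [← ofReal_critValue, ← ofReal_critValue] at hd'
    refine ⟨critValue r a x, (critValue r a u : ℝ), (critValue r a v : ℝ), hz0, hc0, hzΩ,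
      hd', fun h => absurd h hd.not_gt,
      fun _ => ⟨Complex.ofReal_im _, Complex.ofReal_im _, ?_, ?_, ?_⟩, fun h => absurd h hd.ne'⟩
    · rw [Complex.ofReal_re, Complex.ofReal_re, ← sub_pos, critValue_sub hu0.ne hv0.ne huv.ne r1 r2,
        hpR]
      have : (u - v) ^ 3 = -δ ^ 3 := by rw [hu, hv]; ring
      rw [this, neg_mul_neg]
      positivity
    · rw [Complex.ofReal_re]
      exact below u hu0 r1
    · rw [ofReal_critValue]
      refine critValue_mem_Omega hr ha har c1 ?_
      rw [Complex.norm_real, Real.norm_eq_abs, sq_abs]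
      -- Since u < v < 0, u² > uv = x² - 2a > r.
      nlinarith

end CubicModel

end

theorem mainTheorem9 (t0 t1 : ℝ) (ht : (t0, t1) ∈ CubicModel.paramRegion) :
    -- `∞` is a branch point, of order exactly two
    (∀ k : ℕ, CubicModel.IsBranchPointAtInfinity (CubicModel.spectralF t0 t1) k ↔ k = 2) ∧
    ∃ (z0 : ℝ) (z1 z2 : ℂ) (c0 : ℝ) (c1 c2 : ℂ),
      0 < z0 ∧ (z0 : ℂ) ∈ CubicModel.Omega t0 t1 ∧
      -- off `γ_c`: three distinct finite branch points, of order two, and no others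
      ((t0, t1) ∉ CubicModel.gammaC →
        (z0 : ℂ) ≠ z1 ∧ (z0 : ℂ) ≠ z2 ∧ z1 ≠ z2 ∧
        ∀ (k : ℕ) (b : ℂ), CubicModel.IsBranchPoint (CubicModel.spectralF t0 t1) k b ↔
          k = 2 ∧ (b = z0 ∨ b = z1 ∨ b = z2)) ∧
      -- the three-cut region
      ((t0, t1) ∈ CubicModel.region1 →
        z1.im < 0 ∧ (starRingEnd ℂ) z2 = z1 ∧
        z1 ∈ CubicModel.Omega t0 t1 ∧ z2 ∈ CubicModel.Omega t0 t1) ∧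
      -- the one-cut region
      ((t0, t1) ∈ CubicModel.region2 →
        z1.im = 0 ∧ z2.im = 0 ∧ z2.re < z1.re ∧ z1.re < z0 ∧
        z1 ∈ CubicModel.Omega t0 t1) ∧
      -- on `γ_c`: `z1 = z2` is real of order three, `z0` has order two, and there are no others
      ((t0, t1) ∈ CubicModel.gammaC →
        z1 = z2 ∧ z1.im = 0 ∧ z1.re < z0 ∧ z1 ∈ CubicModel.Omega t0 t1 ∧
        ∀ (k : ℕ) (b : ℂ), CubicModel.IsBranchPoint (CubicModel.spectralF t0 t1) k b ↔
          (k = 2 ∧ b = z0) ∨ (k = 3 ∧ b = z1)) ∧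
      -- the critical points, on the whole region
      (∀ z : ℂ, CubicModel.IsCriticalPoint (CubicModel.spectralF t0 t1) z ↔
        z = c0 ∨ z = c1 ∨ z = c2) ∧
      (c0 : ℂ) ∉ closure (CubicModel.Omega t0 t1) ∧
      c1 ∉ closure (CubicModel.Omega t0 t1) ∧
      c2 ∉ closure (CubicModel.Omega t0 t1) ∧
      z0 < c0 ∧ c1.im < 0 ∧ (starRingEnd ℂ) c2 = c1 := by
  obtain ⟨r, a, hr, ha, har, rfl, rfl⟩ := CubicModel.paramRegion_exists ht
  rw [CubicModel.spectralF_paramT hr ha har, CubicModel.gammaC_iff hr ha har]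
  have ha2 : a < 1 / 2 := by linarith
  obtain ⟨z0, z1, z2, h0, hc0, hΩ, h1, h2, h3, h4⟩ := CubicModel.branchPoints_of_param hr ha har
  have hcrit := fun z : ℂ => CubicModel.isCriticalPoint_iff_eq hr ha har (z := z)
  have him := (CubicModel.nodeProduct_sq ha ha2).2.2
  have hr1 : 0 < 1 - r ^ 2 := by nlinarith
  refine ⟨CubicModel.isBranchPointAtInfinity_iff hr ha har, z0, z1, z2, 1 - a - r ^ 2,
    (1 - r ^ 2) * (starRingEnd ℂ) (CubicModel.nodeProduct a) - a,
    (1 - r ^ 2) * CubicModel.nodeProduct a - a, h0, hΩ, h1,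
    fun h => h2 (CubicModel.lt_of_region1 hr ha har h),
    fun h => h3 (CubicModel.lt_of_region2 hr ha har h), h4, hcrit,
    ((hcrit _).2 (by simp)).not_mem_closure hr ha har,
    ((hcrit _).2 (by simp)).not_mem_closure hr ha har,
    ((hcrit _).2 (by simp)).not_mem_closure hr ha har, hc0, ?_, by simp⟩
  have : (1 - (r : ℂ) ^ 2) = ((1 - r ^ 2 : ℝ) : ℂ) := by push_cast; ring
  rw [this, Complex.sub_im, Complex.im_ofReal_mul, Complex.conj_im, Complex.ofReal_im]
  nlinarith
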